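/- Let $p:\mathbb Z\to[0,1]$ be a finite-range jump law, $\sum_z p(z)=1$, with non-zero drift $b=\sum_z z\,p(z)\neq 0$. For $\rho\in(0,1)$ let $\pi_\rho$ be the Bernoulli product measure with density $\rho$ on $\{0,1\}^{\mathbb Z}$, and put $\hat\eta_x=(\eta_x-\rho)/\sqrt{\rho(1-\rho)}$, $\hat\eta_A=\prod_{x\in A}\hat\eta_x$. Let $L$ be the generator in $L^2(\pi_\rho)$ of the exclusion process with jump law $p$, i.e. the closure of $$Lf(\eta)=\sum_{x,z\in\mathbb Z}p(z)\,\eta_x(1-\eta_{x+z})\,\bigl(f(\eta^{x,x+z})-f(\eta)\bigr),\qquad f \text{ local (depending on finitely many } \eta_x),$$ where $\eta^{x,y}$ is $\eta$ with the values at $x$ and $y$ interchanged, and let $L^{TASEP}$ be the generator for the jump law $p(1)=1$. Let $\langle\!\langle\phi,\psi\rangle\!\rangle=\sum_{x\in\mathbb Z}\int\phi\;\tau_x\psi\,d\pi_\rho$, where $\tau_x$ is the translation with $\tau_x\hat\eta_y=\hat\eta_{x+y}$, and for $\lambda>0$ and $G=L$ or $G=L^{TASEP}$ let $$|\!|\!|\phi|\!|\!|_{-1,\lambda,G}=\langle\!\langle\phi,(\lambda-G)^{-1}\phi\rangle\!\rangle^{1/2}.$$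 Let $w=\sum_z z\,p(z)\,\hat\eta_{\{0,z\}}$ and $w^{TASEP}=\hat\eta_{\{0,1\}}$ be the currents. Then there is a constant $C<\infty$, depending only on $p$, such that for all $\rho\in(0,1)$ and all $0<\lambda<1$: 1. $|\!|\!|w-b\,w^{TASEP}|\!|\!|_{-1,\lambda,L^{TASEP}}\le C$; 2. if $\gcd\{z: p(z)>0\}=1$, also $|\!|\!|w-b\,w^{TASEP}|\!|\!|_{-1,\lambda,L}\le C$. In both cases the norm is well defined: $(\lambda-G)^{-1}(w-b\,w^{TASEP})$ exists and is unique in $L^2(\pi_\rho)$, the sum over translations converges absolutely, and its value is nonnegative. -/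

import Mathlib

open MeasureTheory ProbabilityTheory Filter Topology

noncomputable section

namespace AEP

/-- Particle configurations on `ℤ`: `η x = true` means that the site `x` is occupied. -/
abbrev Config : Type := ℤ → Bool

/-- The occupation variable `η_x ∈ {0, 1}`, as a real number. -/
def occ (η : Config) (x : ℤ) : ℝ := if η x then 1 else 0

/-- The configuration `η^{x,y}`, with the occupation variables at `x` and `y` interchanged. -/
def exchange (η : Config) (x y : ℤ) : Config := fun u => η (Equiv.swap x y u)

/-- The shifted configuration, `(shift x η)_y = η_{x+y}`. -/
def shift (x : ℤ) (η : Config) : Config := fun y => η (x + y)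

/-- The translation `τ_x` on functions: `(τ_x f)(η) = f (shift x η)`. -/
def translate (x : ℤ) (f : Config → ℝ) : Config → ℝ := fun η => f (shift x η)

/-- A finite-range jump law on `ℤ`: a probability vector with finite support. -/
structure IsJumpLaw (p : ℤ → ℝ) : Prop where
  nonneg : ∀ z, 0 ≤ p z
  finiteRange : ∃ R : ℕ, ∀ z : ℤ, (R : ℤ) < |z| → p z = 0
  sum_one : ∑' z, p z = 1

/-- The drift `b = ∑_z z p(z)`. -/
def drift (p : ℤ → ℝ) : ℝ := ∑' z : ℤ, (z : ℝ) * p z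

/-- `gcd {z : p(z) > 0} = 1`: every common divisor of the possible jumps is a unit. -/
def IsIrreducibleLaw (p : ℤ → ℝ) : Prop :=
  ∀ d : ℤ, (∀ z, 0 < p z → d ∣ z) → IsUnit d

/-- The jump law of the totally asymmetric simple exclusion process, `p(1) = 1`. -/
def tasep : ℤ → ℝ := Pi.single 1 1

/-- The Bernoulli product measure `π_ρ` on configurations. -/
def bernoulliProd (ρ : unitInterval) : Measure Config :=
  Measure.infinitePi fun _ : ℤ => bernoulliMeasure true false ρ

/-- Local functions: those that depend on finitely many occupation variables only. -/
def IsLocal (f : Config → ℝ) : Prop := ∃ A : Finset ℤ, DependsOn f (A : Set ℤ)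

/-- The generator of the exclusion process on local functions,
`L f(η) = ∑_{x,z} p(z) η_x (1 - η_{x+z}) (f(η^{x,x+z}) - f(η))`.
For a local `f` and a finite-range `p` only finitely many terms are nonzero. -/
def generator (p : ℤ → ℝ) (f : Config → ℝ) (η : Config) : ℝ :=
  ∑' x : ℤ, ∑' z : ℤ,
    p z * occ η x * (1 - occ η (x + z)) * (f (exchange η x (x + z)) - f η)

/-- `g = L f`, where `L` is the closure in `L²(π_ρ)` of the generator on local functions:
`(f, g)` is an `L²(π_ρ)`-limit of pairs `(fₙ, L fₙ)` with `fₙ` local. -/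
def IsClosedGenerator (p : ℤ → ℝ) (ρ : unitInterval) (f g : Config → ℝ) : Prop :=
  MemLp f 2 (bernoulliProd ρ) ∧ MemLp g 2 (bernoulliProd ρ) ∧
    ∃ F : ℕ → Config → ℝ, (∀ n, IsLocal (F n)) ∧
      Tendsto (fun n => eLpNorm (F n - f) 2 (bernoulliProd ρ)) atTop (𝓝 0) ∧
      Tendsto (fun n => eLpNorm (generator p (F n) - g) 2 (bernoulliProd ρ)) atTop (𝓝 0)

/-- `ψ = (lam - L)⁻¹ φ` in `L²(π_ρ)`: `ψ` is in the domain of `L` and `L ψ = lam ψ - φ`. -/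
def IsResolvent (p : ℤ → ℝ) (ρ : unitInterval) (lam : ℝ) (φ ψ : Config → ℝ) : Prop :=
  IsClosedGenerator p ρ ψ (lam • ψ - φ)

/-- A representative of `(lam - L)⁻¹ φ`. -/
def resolvent (p : ℤ → ℝ) (ρ : unitInterval) (lam : ℝ) (φ : Config → ℝ) : Config → ℝ :=
  Classical.epsilon (IsResolvent p ρ lam φ)

/-- The inner product `⟨f, g⟩ = ∫ f g dπ_ρ`. -/
def inner2 (ρ : unitInterval) (f g : Config → ℝ) : ℝ := ∫ η, f η * g η ∂(bernoulliProd ρ)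

/-- The translation-summed inner product `⟨⟨φ, ψ⟩⟩ = ∑_x ⟨φ, τ_x ψ⟩`. -/
def innerSum (ρ : unitInterval) (φ ψ : Config → ℝ) : ℝ :=
  ∑' x : ℤ, inner2 ρ φ (translate x ψ)

/-- The norm `|||φ|||_{-1,lam} = ⟨⟨φ, (lam - L)⁻¹ φ⟩⟩^{1/2}` for the process with jump law `p`. -/
def normHm1 (p : ℤ → ℝ) (ρ : unitInterval) (lam : ℝ) (φ : Config → ℝ) : ℝ :=
  Real.sqrt (innerSum ρ φ (resolvent p ρ lam φ))

/-- The expression defining `|||φ|||_{-1,lam}` is meaningful: `(lam - L)⁻¹ φ` exists and is unique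
in `L²(π_ρ)`, the sum over translations converges absolutely, and its value is nonnegative. -/
def NormHm1WellDefined (p : ℤ → ℝ) (ρ : unitInterval) (lam : ℝ) (φ : Config → ℝ) : Prop :=
  (∃ ψ, IsResolvent p ρ lam φ ψ ∧
    ∀ ψ', IsResolvent p ρ lam φ ψ' → ψ' =ᵐ[bernoulliProd ρ] ψ) ∧
  Summable (fun x : ℤ => inner2 ρ φ (translate x (resolvent p ρ lam φ))) ∧
  0 ≤ innerSum ρ φ (resolvent p ρ lam φ)

/-- The normalised occupation variable `(η_x - ρ) / √(ρ (1 - ρ))`. -/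
def hatEta (ρ : unitInterval) (x : ℤ) (η : Config) : ℝ :=
  (occ η x - ρ) / Real.sqrt ((ρ : ℝ) * (1 - ρ))

/-- The product of the normalised occupation variables over the finite set `A`. -/
def hatEtaSet (ρ : unitInterval) (A : Finset ℤ) (η : Config) : ℝ := ∏ x ∈ A, hatEta ρ x η

/-- The current `w = ∑_z z p(z) η̂_{{0,z}}`. -/
def current (p : ℤ → ℝ) (ρ : unitInterval) (η : Config) : ℝ :=
  ∑' z : ℤ, (z : ℝ) * p z * hatEtaSet ρ {0, z} η

end AEP

end

namespace AEP

/-! Write φ for the difference w − b w^TASEP. It equals ∑_z z p(z) (η̂_0 η̂_z − η̂_0 η̂_1), and the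
exchange of the sites 1 and z carries one product into the other. Since the products have unit norm,
pairing such a difference with a local f costs at most the square root of the Dirichlet energy of
one exchange over the distance z − 1, whatever the density (`inner2_hatPair_sub_sq_le`). A long
exchange is a conjugate of shorter ones, so the distances whose total energy is dominated by the
Dirichlet form of G make up a subgroup of ℤ. It contains the possible jumps, hence is all of ℤ when
their gcd is 1 (`controlled_eq_top`); this covers both TASEP and an irreducible p. Consequently Φ_N,
the sum of N consecutive translates of φ, satisfies ⟨Φ_N, f⟩² ≤ K N ⟨f, −G f⟩ with K independent of
ρ and λ.

If ψ is the resolvent of φ, the sum Ψ_N of its translates is the resolvent of Φ_N, and inserting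
approximants of Ψ_N for f gives 0 ≤ ⟨Φ_N, Ψ_N⟩ ≤ K N. Divided by N, the left side is a Cesàro mean
converging to ⟨⟨φ, ψ⟩⟩, which therefore lies in [0, K] (`normHm1_le`).

This limit needs absolute convergence of the sum over translations. A hole-filling estimate shows
that the L² distance from ψ to the functions of the sites in [−k, k] decays geometrically in k
(`resolvent_decay`), with a rate that may depend on λ. A centred translate of φ living outside [−k,
k] is orthogonal to those functions, so its correlation with ψ is bounded by that distance. The same
projections show that λ − G has dense range, which gives existence of the resolvent. -/

lemma summable_of_contraction {s : ℕ → ℝ} {θ : ℝ} {r T : ℕ} (hs : ∀ n, 0 ≤ s n) (h0 : 0 ≤ θ)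
    (h1 : θ < 1) (h : ∀ j, r ≤ j → s (j + T) ≤ θ * s j) : Summable s := by
  rw [← summable_nat_add_iff (r + T)]
  set A := ∑ n ∈ Finset.range T, s (n + r) with hA
  -- The tail sums X satisfy X ≤ θ (A + X), which rearranges to this bound.
  refine summable_of_sum_range_le (c := θ * A / (1 - θ)) (fun n => hs _) fun N => ?_
  set X := ∑ n ∈ Finset.range N, s (n + (r + T)) with hX
  have hX1 : X ≤ θ * ∑ n ∈ Finset.range N, s (n + r) := by
    rw [Finset.mul_sum]
    refine Finset.sum_le_sum fun n _ => ?_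
    rw [← add_assoc]
    exact h _ (by omega)
  have hX2 : ∑ n ∈ Finset.range N, s (n + r) ≤ ∑ n ∈ Finset.range (T + N), s (n + r) :=
    Finset.sum_le_sum_of_subset_of_nonneg (by simp) fun _ _ _ => hs _
  have hX3 : ∑ n ∈ Finset.range (T + N), s (n + r) = A + X := by
    rw [Finset.sum_range_add]
    congr 1
    refine Finset.sum_congr rfl fun n _ => ?_
    congr 1
    omega
  rw [le_div_iff₀ (by linarith)]
  have := mul_le_mul_of_nonneg_left hX2 h0
  rw [hX3] at this
  linarith

/-! ### Resolvents of dissipative finite-range operators in a Hilbert space -/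

section Abstract

open scoped RealInnerProductSpace

variable {H : Type*} [NormedAddCommGroup H] [InnerProductSpace ℝ H]
  {E : Type*} [AddCommGroup E] [Module ℝ E]

/-- `(u, v)` is in the closure of the graph `{(ι f, T f)}`. -/
def InClosure (ι T : E →ₗ[ℝ] H) (u v : H) : Prop :=
  ∃ F : ℕ → E, Tendsto (fun n => ι (F n)) atTop (𝓝 u) ∧ Tendsto (fun n => T (F n)) atTop (𝓝 v)

/-- A dissipative operator of finite range `S` with respect to a filtration `V` of local
elements: it maps `V k` to `V k` up to a boundary term, which lies in `V (k + S)`, is bounded, and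
only sees the part of its argument outside `V (k - S)`. -/
structure IsFiniteRangeDissipative (ι T : E →ₗ[ℝ] H) (V : ℕ → Submodule ℝ E) (S : ℕ) (C : ℝ) :
    Prop where
  mono : Monotone V
  dissip : ∀ f, ⟪ι f, T f⟫ ≤ 0
  split : ∀ k, ∀ f ∈ V k, ∃ a ∈ V k, ∃ b ∈ V (k + S), T f = ι a + ι b ∧
    ∀ j, j + S ≤ k → ∀ g ∈ V j, ‖ι b‖ ≤ C * ‖ι f - ι g‖
  finite : ∀ k, FiniteDimensional ℝ ((V k).map ι)
  dense : ⊤ ≤ (⨆ k, (V k).map ι).topologicalClosure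

variable {ι T : E →ₗ[ℝ] H} {V : ℕ → Submodule ℝ E} {S : ℕ} {C : ℝ} {u v u' v' : H}

lemma inClosure_apply (f : E) : InClosure ι T (ι f) (T f) :=
  ⟨fun _ => f, tendsto_const_nhds, tendsto_const_nhds⟩

lemma InClosure.add (h : InClosure ι T u v) (h' : InClosure ι T u' v') :
    InClosure ι T (u + u') (v + v') := by
  obtain ⟨F, h1, h2⟩ := h
  obtain ⟨G, h3, h4⟩ := h'
  exact ⟨F + G, by simpa using h1.add h3, by simpa using h2.add h4⟩

lemma InClosure.sub (h : InClosure ι T u v) (h' : InClosure ι T u' v') :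
    InClosure ι T (u - u') (v - v') := by
  obtain ⟨F, h1, h2⟩ := h
  obtain ⟨G, h3, h4⟩ := h'
  exact ⟨F - G, by simpa using h1.sub h3, by simpa using h2.sub h4⟩

lemma InClosure.sum {α : Type*} (s : Finset α) {u v : α → H}
    (h : ∀ i ∈ s, InClosure ι T (u i) (v i)) :
    InClosure ι T (∑ i ∈ s, u i) (∑ i ∈ s, v i) := by
  classical
  induction s using Finset.induction_on with
  | empty => simpa using inClosure_apply (ι := ι) (T := T) 0
  | insert a s ha ih =>
    rw [Finset.sum_insert ha, Finset.sum_insert ha]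
    exact (h a (by simp)).add (ih fun i hi => h i (by simp [hi]))

lemma InClosure.inner_nonpos (hT : ∀ f, ⟪ι f, T f⟫ ≤ 0) (h : InClosure ι T u v) : ⟪u, v⟫ ≤ 0 := by
  obtain ⟨F, h1, h2⟩ := h
  exact le_of_tendsto (h1.inner h2) (Eventually.of_forall fun n => hT _)

lemma InClosure.resolvent_unique (hT : ∀ f, ⟪ι f, T f⟫ ≤ 0) {lam : ℝ} (hl : 0 < lam) {φ ψ ψ' : H}
    (h : InClosure ι T ψ (lam • ψ - φ)) (h' : InClosure ι T ψ' (lam • ψ' - φ)) : ψ' = ψ := by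
  have h1 := (h'.sub h).inner_nonpos hT
  rw [sub_sub_sub_cancel_right, ← smul_sub, real_inner_smul_right,
    real_inner_self_eq_norm_sq] at h1
  have h2 : ‖ψ' - ψ‖ = 0 := by
    have := sq_nonneg ‖ψ' - ψ‖
    have : ‖ψ' - ψ‖ ^ 2 = 0 := by nlinarith
    simpa using this
  exact sub_eq_zero.mp (norm_eq_zero.mp h2)

/-- The orthogonal projection onto the `k`-th space of local elements. -/
noncomputable def localProj (ι : E →ₗ[ℝ] H) (V : ℕ → Submodule ℝ E)
    (h : ∀ k, FiniteDimensional ℝ ((V k).map ι)) (k : ℕ) (u : H) : H :=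
  have := h k
  ((V k).map ι).starProjection u

section localProj

variable (h : ∀ k, FiniteDimensional ℝ ((V k).map ι))

lemma localProj_mem (k : ℕ) (u : H) : localProj ι V h k u ∈ (V k).map ι := by
  have := h k
  exact Submodule.starProjection_apply_mem _ u

lemma inner_sub_localProj (k : ℕ) (u : H) {w : H} (hw : w ∈ (V k).map ι) :
    ⟪u - localProj ι V h k u, w⟫ = 0 := by
  have := h k
  exact Submodule.starProjection_inner_eq_zero u w hw

lemma norm_sq_sub_localProj (k : ℕ) (u : H) {w : H} (hw : w ∈ (V k).map ι) :
    ‖u - w‖ ^ 2 = ‖u - localProj ι V h k u‖ ^ 2 + ‖localProj ι V h k u - w‖ ^ 2 := by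
  have := inner_sub_localProj h k u (sub_mem (localProj_mem h k u) hw)
  have h2 := norm_add_sq_real (u - localProj ι V h k u) (localProj ι V h k u - w)
  rw [this, sub_add_sub_cancel] at h2
  linarith

lemma localProj_mem_of_le (hV : Monotone V) {k l : ℕ} (hkl : k ≤ l) (u : H) :
    localProj ι V h k u ∈ (V l).map ι :=
  Submodule.map_mono (hV hkl) (localProj_mem h k u)

lemma norm_sub_localProj_antitone (hV : Monotone V) (u : H) :
    Antitone fun k => ‖u - localProj ι V h k u‖ := by
  intro k l hkl
  have h1 := norm_sq_sub_localProj h l u (localProj_mem_of_le h hV hkl u)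
  refine le_of_sq_le_sq ?_ (norm_nonneg _)
  nlinarith [sq_nonneg ‖localProj ι V h l u - localProj ι V h k u‖]

/-- Turns decay of the projection error of `u` into decay of correlations with elements living far
away. -/
lemma abs_inner_le_of_orthogonal (k : ℕ) (u w : H) (hw : ∀ g ∈ V k, ⟪w, ι g⟫ = 0) :
    |⟪w, u⟫| ≤ ‖w‖ * ‖u - localProj ι V h k u‖ := by
  obtain ⟨g, hg, hg'⟩ := localProj_mem h k u
  have : ⟪w, u⟫ = ⟪w, u - localProj ι V h k u⟫ := by
    rw [inner_sub_right, ← hg', hw g hg, sub_zero]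
  rw [this]
  exact abs_real_inner_le_norm _ _

lemma localProj_tendsto [CompleteSpace H] (hV : Monotone V)
    (hd : ⊤ ≤ (⨆ k, (V k).map ι).topologicalClosure) (u : H) :
    Tendsto (fun k => localProj ι V h k u) atTop (𝓝 u) := by
  have := h
  exact Submodule.starProjection_tendsto_self (fun k => (V k).map ι)
    (fun k l hkl => Submodule.map_mono (hV hkl)) u hd

end localProj

namespace IsFiniteRangeDissipative

/-- The range of `lam - T` is dense. -/
lemma eq_zero_of_orthogonal [CompleteSpace H] (hT : IsFiniteRangeDissipative ι T V S C)
    {lam : ℝ} (hl : 0 < lam) {g : H} (hg : ∀ f, ⟪g, lam • ι f - T f⟫ = 0) : g = 0 := by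
  set P := fun k => localProj ι V hT.finite k g with hP
  have hlim : Tendsto P atTop (𝓝 g) := localProj_tendsto hT.finite hT.mono hT.dense g
  -- Test the orthogonality on the projection of `g`: the inner part `a` of its image is orthogonal
  -- to `g - P k`, so apart from the dissipative term only the boundary part `b` remains, paired
  -- with `g - P k`, which tends to 0.
  have key : ∀ k, S ≤ k → lam * ‖P k‖ ^ 2 ≤ ‖g - P k‖ * (C * ‖P k‖) := by
    intro k hk
    obtain ⟨f, hf, hf'⟩ := localProj_mem hT.finite k g
    obtain ⟨a, ha, b, hb, hab, hbound⟩ := hT.split k f hf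
    have h1 := hg f
    rw [inner_sub_right, real_inner_smul_right] at h1
    have h2 : ⟪g, ι f⟫ = ‖P k‖ ^ 2 := by
      have := inner_sub_localProj hT.finite k g (localProj_mem hT.finite k g)
      rw [inner_sub_left, real_inner_self_eq_norm_sq] at this
      rw [hf']
      linarith
    have h3 : ⟪g, T f⟫ = ⟪ι f, T f⟫ + ⟪g - P k, ι b⟫ := by
      have h4 := inner_sub_localProj hT.finite k g (Submodule.mem_map_of_mem ha)
      have h5 : g = ι f + (g - P k) := by rw [hf']; simp [hP]
      conv_lhs => rw [h5]
      rw [inner_add_left]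
      congr 1
      rw [hab, inner_add_right]
      simp only [hP]
      rw [h4, zero_add]
    have h6 : ⟪g - P k, ι b⟫ ≤ ‖g - P k‖ * (C * ‖P k‖) := by
      refine (real_inner_le_norm _ _).trans ?_
      gcongr
      have := hbound 0 (by omega) 0 (zero_mem _)
      rw [map_zero, sub_zero, hf'] at this
      exact this
    have := hT.dissip f
    rw [h2] at h1
    linarith
  have l1 : Tendsto (fun k => lam * ‖P k‖ ^ 2) atTop (𝓝 (lam * ‖g‖ ^ 2)) :=
    (hlim.norm.pow 2).const_mul lam
  have l2 : Tendsto (fun k => ‖g - P k‖ * (C * ‖P k‖)) atTop (𝓝 (‖g - g‖ * (C * ‖g‖))) :=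
    (hlim.const_sub g).norm.mul (hlim.norm.const_mul C)
  have := le_of_tendsto_of_tendsto l1 l2 (eventually_atTop.mpr ⟨S, key⟩)
  rw [sub_self, norm_zero, zero_mul] at this
  have : ‖g‖ ^ 2 = 0 := by nlinarith [sq_nonneg ‖g‖]
  simpa using this

/-- Dissipativity gives `lam * ‖ι f‖ ≤ ‖R f‖`, so approximate preimages of `φ`, available because
the range is dense, form a Cauchy sequence. -/
lemma exists_resolvent [CompleteSpace H] (hT : IsFiniteRangeDissipative ι T V S C)
    {lam : ℝ} (hl : 0 < lam) (φ : H) : ∃ ψ, InClosure ι T ψ (lam • ψ - φ) := by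
  set R : E →ₗ[ℝ] H := lam • ι - T with hR
  have hRa : ∀ f, R f = lam • ι f - T f := fun f => rfl
  have hd : R.range.topologicalClosure = ⊤ := by
    rw [Submodule.topologicalClosure_eq_top_iff, Submodule.eq_bot_iff]
    intro g hg
    refine hT.eq_zero_of_orthogonal hl fun f => ?_
    rw [← hRa, real_inner_comm]
    exact hg (R f) ⟨f, rfl⟩
  have hmem : φ ∈ closure (R.range : Set H) := by
    have : φ ∈ R.range.topologicalClosure := by rw [hd]; trivial
    exact this
  obtain ⟨x, hx, hxl⟩ := mem_closure_iff_seq_limit.mp hmem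
  choose F hF using hx
  have hbound : ∀ f, lam * ‖ι f‖ ≤ ‖R f‖ := by
    intro f
    have h1 := real_inner_le_norm (ι f) (R f)
    have h2 := hT.dissip f
    rw [hRa, inner_sub_right, real_inner_smul_right, real_inner_self_eq_norm_sq, ← hRa] at h1
    rcases (norm_nonneg (ι f)).eq_or_lt with h0 | h0
    · rw [← h0]; simp
    · refine le_of_mul_le_mul_left ?_ h0
      nlinarith
  have hcau : CauchySeq fun n => ι (F n) := by
    have hx' := hxl.cauchySeq
    rw [Metric.cauchySeq_iff] at hx' ⊢
    intro ε hε
    obtain ⟨N, hN⟩ := hx' (lam * ε) (by positivity)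
    refine ⟨N, fun m hm n hn => ?_⟩
    have h1 := hN m hm n hn
    have h2 := hbound (F m - F n)
    rw [dist_eq_norm, ← hF, ← hF, ← map_sub] at h1
    rw [dist_eq_norm, ← map_sub]
    exact lt_of_mul_lt_mul_left (h2.trans_lt h1) hl.le
  obtain ⟨ψ, hψ⟩ := cauchySeq_tendsto_of_complete hcau
  refine ⟨ψ, F, hψ, ?_⟩
  have : (fun n => T (F n)) = fun n => lam • ι (F n) - x n := by
    funext n
    rw [← hF, hRa]
    abel
  rw [this]
  exact (hψ.const_smul lam).sub hxl

/-- Spatial decay of the resolvent of a local element. -/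
lemma resolvent_decay [CompleteSpace H] (hT : IsFiniteRangeDissipative ι T V S C)
    (hC : 0 ≤ C) {lam : ℝ} (hl : 0 < lam) {r : ℕ} {φ ψ : H} (hφ : φ ∈ (V r).map ι)
    (hψ : InClosure ι T ψ (lam • ψ - φ)) {j : ℕ} (hj : r ≤ j) :
    (C + lam) * ‖ψ - localProj ι V hT.finite (j + 2 * S) ψ‖ ^ 2 ≤
      C * ‖ψ - localProj ι V hT.finite j ψ‖ ^ 2 := by
  set P := fun k => localProj ι V hT.finite k ψ with hP
  have e1 := norm_sq_sub_localProj hT.finite (j + S) ψ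
    (localProj_mem_of_le hT.finite hT.mono (Nat.le_add_right j S) ψ)
  have e2 := norm_sq_sub_localProj hT.finite (j + 2 * S) ψ
    (localProj_mem_of_le hT.finite hT.mono (show j + S ≤ j + 2 * S by omega) ψ)
  have e3 := norm_sub_localProj_antitone hT.finite hT.mono ψ (show j + S ≤ j + 2 * S by omega)
  obtain ⟨f, hf, hf'⟩ := localProj_mem hT.finite (j + S) ψ
  obtain ⟨g, hg, hg'⟩ := localProj_mem hT.finite j ψ
  obtain ⟨a, ha, b, hb, hab, hbound⟩ := hT.split (j + S) f hf
  have hb1 := hbound j le_rfl g hg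
  rw [hf', hg'] at hb1
  -- Dissipativity is applied to `ψ - P (j + S)`. The source `φ` and the inner part `a` are
  -- orthogonal to it; `b` lies in `V (j + 2 * S)`, so it sees only the increment between the two
  -- projections.
  have key : lam * ‖ψ - P (j + S)‖ ^ 2 ≤ ⟪P (j + 2 * S) - P (j + S), ι b⟫ := by
    have k1 : ⟪ψ - P (j + S), φ⟫ = 0 :=
      inner_sub_localProj _ _ _ (Submodule.map_mono (hT.mono (by omega)) hφ)
    have k2 : ⟪ψ - P (j + S), P (j + S)⟫ = 0 :=
      inner_sub_localProj _ _ _ (localProj_mem _ _ _)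
    have k3 : ⟪ψ - P (j + S), ι a⟫ = 0 :=
      inner_sub_localProj _ _ _ (Submodule.mem_map_of_mem ha)
    have k4 : ⟪ψ - P (j + 2 * S), ι b⟫ = 0 := by
      refine inner_sub_localProj _ _ _ (Submodule.mem_map_of_mem ?_)
      rwa [show j + 2 * S = j + S + S by ring]
    have k5 := (hψ.sub (inClosure_apply f)).inner_nonpos hT.dissip
    rw [hf'] at k5
    change ⟪ψ - P (j + S), _⟫ ≤ 0 at k5
    rw [hab, inner_sub_right, inner_sub_right, inner_add_right, k1, k3,
      real_inner_smul_right] at k5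
    have k6 : ⟪ψ - P (j + S), ψ⟫ = ‖ψ - P (j + S)‖ ^ 2 := by
      rw [← real_inner_self_eq_norm_sq, inner_sub_right _ ψ, k2, sub_zero]
    have k7 : ⟪ψ - P (j + S), ι b⟫ = ⟪P (j + 2 * S) - P (j + S), ι b⟫ := by
      rw [← sub_add_sub_cancel ψ (P (j + 2 * S)) (P (j + S)), inner_add_left, k4, zero_add]
    rw [← k7]
    rw [k6] at k5
    linarith
  have k8 := real_inner_le_norm (P (j + 2 * S) - P (j + S)) (ι b)
  simp only [hP] at *
  set A := ‖localProj ι V hT.finite (j + 2 * S) ψ - localProj ι V hT.finite (j + S) ψ‖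
  set B := ‖localProj ι V hT.finite (j + S) ψ - localProj ι V hT.finite j ψ‖
  have k9 : A * ‖ι b‖ ≤ A * (C * B) := by gcongr
  have k10 : A * (C * B) ≤ C / 2 * (A ^ 2 + B ^ 2) := by nlinarith [sq_nonneg (A - B)]
  have k11 := pow_le_pow_left₀ (norm_nonneg _) e3 2
  have k12 := mul_le_mul_of_nonneg_left k11 hl.le
  -- Hole filling: by Pythagoras the two increments add up to the drop of the squared error between
  -- `j` and `j + 2 * S`, so the error at `j + 2 * S` can be moved to the left-hand side.
  have k13 : C * (A ^ 2 + B ^ 2) = C * ‖ψ - localProj ι V hT.finite j ψ‖ ^ 2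
      - C * ‖ψ - localProj ι V hT.finite (j + 2 * S) ψ‖ ^ 2 := by
    rw [e1, e2]
    ring
  have k14 : 0 ≤ C * (A ^ 2 + B ^ 2) := by positivity
  linarith

lemma summable_resolvent_decay [CompleteSpace H] (hT : IsFiniteRangeDissipative ι T V S C)
    (hC : 0 ≤ C) {lam : ℝ} (hl : 0 < lam) {r : ℕ} {φ ψ : H} (hφ : φ ∈ (V r).map ι)
    (hψ : InClosure ι T ψ (lam • ψ - φ)) :
    Summable fun k => ‖ψ - localProj ι V hT.finite k ψ‖ := by
  have hCl : 0 < C + lam := by linarith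
  refine summable_of_contraction (θ := √(C / (C + lam))) (r := r) (T := 2 * S)
    (fun n => norm_nonneg _) (Real.sqrt_nonneg _) ?_ fun j hj => ?_
  · rw [Real.sqrt_lt' one_pos, one_pow, div_lt_one hCl]
    linarith
  · refine le_of_sq_le_sq ?_ (by positivity)
    rw [mul_pow, Real.sq_sqrt (by positivity), div_mul_eq_mul_div, le_div_iff₀ hCl]
    linarith [hT.resolvent_decay hC hl hφ hψ hj]

end IsFiniteRangeDissipative

end Abstract

/-! ### Local functions and site permutations -/

section Local

variable {f g : Config → ℝ}

lemma IsLocal.of_dependsOn {A : Finset ℤ} (hf : DependsOn f (A : Set ℤ)) : IsLocal f := ⟨A, hf⟩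

lemma IsLocal.exists_comp (hf : IsLocal f) :
    ∃ (A : Finset ℤ) (g : (↥(A : Set ℤ) → Bool) → ℝ), f = g ∘ (A : Set ℤ).domRestrict := by
  obtain ⟨A, hA⟩ := hf
  exact ⟨A, dependsOn_iff_exists_comp.mp hA⟩

lemma IsLocal.continuous (hf : IsLocal f) : Continuous f := by
  obtain ⟨A, g, rfl⟩ := hf.exists_comp
  have hg : Continuous g := continuous_of_discreteTopology
  exact hg.comp (continuous_pi fun i => continuous_apply _)

lemma IsLocal.measurable (hf : IsLocal f) : Measurable f := hf.continuous.measurable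

lemma IsLocal.exists_bound (hf : IsLocal f) : ∃ M, ∀ η, ‖f η‖ ≤ M := by
  obtain ⟨M, hM⟩ := isCompact_univ.exists_bound_of_continuousOn hf.continuous.continuousOn
  exact ⟨M, fun η => hM η trivial⟩

lemma IsLocal.binary (hf : IsLocal f) (hg : IsLocal g) (F : ℝ → ℝ → ℝ) :
    IsLocal fun η => F (f η) (g η) := by
  obtain ⟨A, hA⟩ := hf
  obtain ⟨B, hB⟩ := hg
  refine ⟨A ∪ B, fun η ξ h => ?_⟩
  simp only
  rw [hA fun i hi => h i (by simp_all), hB fun i hi => h i (by simp_all)]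

lemma IsLocal.add (hf : IsLocal f) (hg : IsLocal g) : IsLocal (f + g) := hf.binary hg (· + ·)

lemma IsLocal.sub (hf : IsLocal f) (hg : IsLocal g) : IsLocal (f - g) := hf.binary hg (· - ·)

lemma IsLocal.mul (hf : IsLocal f) (hg : IsLocal g) : IsLocal (f * g) := hf.binary hg (· * ·)

lemma IsLocal.smul (hf : IsLocal f) (c : ℝ) : IsLocal (c • f) := hf.binary hf fun x _ => c * x

lemma isLocal_const (c : ℝ) : IsLocal fun _ => c := ⟨∅, fun _ _ _ => rfl⟩

lemma isLocal_sum {α : Type*} (s : Finset α) {F : α → Config → ℝ} (h : ∀ i ∈ s, IsLocal (F i)) :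
    IsLocal (∑ i ∈ s, F i) := by
  classical
  induction s using Finset.induction_on with
  | empty => simpa using! isLocal_const 0
  | insert a s ha ih =>
    rw [Finset.sum_insert ha]
    exact (h a (by simp)).add (ih fun i hi => h i (by simp [hi]))

/-- A permutation of the sites acts on configurations. -/
def reindex (σ : Equiv.Perm ℤ) (η : Config) : Config := fun u => η (σ u)

lemma DependsOn.comp_reindex {s : Set ℤ} (hf : DependsOn f s) (σ : Equiv.Perm ℤ) :
    DependsOn (fun η => f (reindex σ η)) (σ '' s) :=
  fun _ _ h => hf fun i hi => h (σ i) ⟨i, hi, rfl⟩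

lemma IsLocal.comp_reindex (hf : IsLocal f) (σ : Equiv.Perm ℤ) :
    IsLocal fun η => f (reindex σ η) := by
  obtain ⟨A, hA⟩ := hf
  refine ⟨A.image σ, ?_⟩
  rw [Finset.coe_image]
  exact DependsOn.comp_reindex hA σ

lemma isLocal_occ (x : ℤ) : IsLocal fun η => occ η x :=
  ⟨{x}, fun η ξ h => by simp [occ, h x (by simp)]⟩

lemma occ_nonneg (η : Config) (x : ℤ) : 0 ≤ occ η x := by unfold occ; split_ifs <;> norm_num

lemma occ_le_one (η : Config) (x : ℤ) : occ η x ≤ 1 := by unfold occ; split_ifs <;> norm_num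

lemma exchange_exchange (η : Config) (x y : ℤ) : exchange (exchange η x y) x y = η := by
  funext u
  simp [exchange]

/-- Exchanges outside the support of `f` leave `f` invariant. -/
lemma DependsOn.apply_exchange {s : Set ℤ} (hf : DependsOn f s) {x y : ℤ} (hx : x ∉ s)
    (hy : y ∉ s) (η : Config) : f (exchange η x y) = f η := by
  refine hf fun i hi => ?_
  have h1 : i ≠ x := fun h => hx (h ▸ hi)
  have h2 : i ≠ y := fun h => hy (h ▸ hi)
  simp [exchange, Equiv.swap_apply_of_ne_of_ne h1 h2]

lemma DependsOn.comp_exchange {s : Set ℤ} (hf : DependsOn f s) {x y : ℤ} (hx : x ∈ s)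
    (hy : y ∈ s) : DependsOn (fun η => f (exchange η x y)) s := by
  refine fun η ξ h => hf fun i hi => h _ ?_
  rcases eq_or_ne i x with rfl | h1
  · simpa
  rcases eq_or_ne i y with rfl | h2
  · simpa
  rwa [Equiv.swap_apply_of_ne_of_ne h1 h2]

end Local

/-! ### The Bernoulli measure and density of local functions -/

section Measure

variable {ρ : unitInterval}

instance : IsProbabilityMeasure (bernoulliProd ρ) := by
  unfold bernoulliProd
  infer_instance

lemma measurePreserving_reindex (ρ : unitInterval) (σ : Equiv.Perm ℤ) :
    MeasurePreserving (reindex σ) (bernoulliProd ρ) (bernoulliProd ρ) := by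
  refine ⟨measurable_pi_lambda _ fun i => measurable_pi_apply _, ?_⟩
  exact Measure.map_infinitePi_infinitePi_of_inj
    (P := fun _ : ℤ => bernoulliMeasure true false ρ) σ.injective

lemma IsLocal.memLp {f : Config → ℝ} (hf : IsLocal f) (q : ENNReal) :
    MemLp f q (bernoulliProd ρ) := by
  obtain ⟨M, hM⟩ := hf.exists_bound
  exact MemLp.of_bound hf.measurable.aestronglyMeasurable M (Eventually.of_forall hM)

lemma IsLocal.integrable {f : Config → ℝ} (hf : IsLocal f) : Integrable f (bernoulliProd ρ) :=
  memLp_one_iff_integrable.mp (hf.memLp 1)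

lemma integral_reindex (σ : Equiv.Perm ℤ) {f : Config → ℝ}
    (hf : AEStronglyMeasurable f (bernoulliProd ρ)) :
    ∫ η, f (reindex σ η) ∂(bernoulliProd ρ) = ∫ η, f η ∂(bernoulliProd ρ) := by
  have h := measurePreserving_reindex ρ σ
  rw [← integral_map h.measurable.aemeasurable (by rwa [h.map_eq]), h.map_eq]

lemma inner_toLp {f g : Config → ℝ} (hf : MemLp f 2 (bernoulliProd ρ))
    (hg : MemLp g 2 (bernoulliProd ρ)) : inner ℝ (hf.toLp f) (hg.toLp g) = inner2 ρ f g := by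
  rw [L2.inner_def]
  refine integral_congr_ae ?_
  filter_upwards [hf.coeFn_toLp, hg.coeFn_toLp] with η h1 h2
  rw [h1, h2]
  simp [mul_comm]

/-- Local functions form a vector space. -/
def localFun : Submodule ℝ (Config → ℝ) where
  carrier := {f | IsLocal f}
  add_mem' hf hg := hf.add hg
  zero_mem' := isLocal_const 0
  smul_mem' c _ hf := hf.smul c

/-- The `L²`-class of a local function. -/
noncomputable def localToLp (ρ : unitInterval) : localFun →ₗ[ℝ] Lp ℝ 2 (bernoulliProd ρ) where
  toFun f := (IsLocal.memLp f.2 2).toLp f.1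
  map_add' _ _ := rfl
  map_smul' _ _ := rfl

lemma localToLp_apply (f : localFun) :
    localToLp ρ f = (IsLocal.memLp f.2 2).toLp f.1 := rfl

/-- Local functions of the sites in `[-k, k]`. -/
def localIcc (k : ℕ) : Submodule ℝ localFun where
  carrier := {f | DependsOn f.1 (Finset.Icc (-k : ℤ) k : Set ℤ)}
  add_mem' hf hg := fun _ _ h => congrArg₂ (· + ·) (hf h) (hg h)
  zero_mem' := fun _ _ _ => rfl
  smul_mem' c _ hf := fun _ _ h => congrArg (c * ·) (hf h)

lemma mem_localIcc {k : ℕ} {f : localFun} :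
    f ∈ localIcc k ↔ DependsOn f.1 (Finset.Icc (-k : ℤ) k : Set ℤ) := Iff.rfl

lemma localIcc_mono : Monotone localIcc := by
  intro k l hkl f hf
  refine DependsOn.mono ?_ hf
  rw [Finset.coe_subset]
  exact Finset.Icc_subset_Icc (by omega) (by omega)

lemma IsLocal.exists_mem_localIcc {f : Config → ℝ} (hf : IsLocal f) :
    ∃ k : ℕ, DependsOn f (Finset.Icc (-k : ℤ) k : Set ℤ) := by
  obtain ⟨A, hA⟩ := hf
  refine ⟨A.sup fun x => x.natAbs, hA.mono ?_⟩
  rw [Finset.coe_subset]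
  intro x hx
  have := Finset.le_sup (f := fun x : ℤ => x.natAbs) hx
  rw [Finset.mem_Icc]
  omega

lemma finiteDimensional_localIcc (k : ℕ) : FiniteDimensional ℝ (localIcc k) := by
  set A : Finset ℤ := Finset.Icc (-k : ℤ) k
  let Φ : ((↥(A : Set ℤ) → Bool) → ℝ) →ₗ[ℝ] localFun :=
    { toFun := fun g => ⟨fun η => g ((A : Set ℤ).domRestrict η),
        A, fun η ξ h => congrArg g (funext fun i => h i i.2)⟩
      map_add' := fun _ _ => rfl
      map_smul' := fun _ _ => rfl }
  refine Submodule.finiteDimensional_of_le (S₂ := Φ.range) ?_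
  intro f hf
  obtain ⟨g, hg⟩ := dependsOn_iff_exists_comp.mp (mem_localIcc.mp hf)
  exact ⟨g, Subtype.ext hg.symm⟩

/-- Local functions are dense in `L²`. -/
lemma dense_localIcc :
    ⊤ ≤ (⨆ k, (localIcc k).map (localToLp ρ)).topologicalClosure := by
  let A : Subalgebra ℝ C(Config, ℝ) :=
    { carrier := {f | IsLocal f}
      mul_mem' := fun hf hg => IsLocal.mul hf hg
      add_mem' := fun hf hg => IsLocal.add hf hg
      algebraMap_mem' := fun c => isLocal_const c }
  -- Stone–Weierstrass on the compact space of configurations, then density of continuous functions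
  -- in L².
  have hA : A.SeparatesPoints := by
    intro η ξ hne
    obtain ⟨x, hx⟩ := Function.ne_iff.mp hne
    refine ⟨_, ⟨⟨_, (isLocal_occ x).continuous⟩, isLocal_occ x, rfl⟩, ?_⟩
    simp only [occ, ContinuousMap.coe_mk]
    cases h1 : η x <;> cases h2 : ξ x <;> simp_all
  have hd := ContinuousMap.subalgebra_topologicalClosure_eq_top_of_separatesPoints A hA
  have hd' : Dense (A : Set C(Config, ℝ)) := by
    intro f
    have : f ∈ A.topologicalClosure := by rw [hd]; trivial
    exact this
  have h := (ContinuousMap.toLp_denseRange ℝ (bernoulliProd ρ) ℝ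
    (p := 2) (by simp)).dense_image (ContinuousMap.toLp 2 (bernoulliProd ρ) ℝ).continuous hd'
  intro u _
  refine closure_mono ?_ (h u)
  rintro _ ⟨f, hf, rfl⟩
  obtain ⟨k, hk⟩ := IsLocal.exists_mem_localIcc hf
  exact Submodule.mem_iSup_of_mem k ⟨⟨f, hf⟩, hk, rfl⟩

end Measure

/-! ### The generator as a finite-range operator -/

section Generator

variable {p : ℤ → ℝ} {ρ : unitInterval} {f g : Config → ℝ} {R k : ℕ}

/-- The contribution of jumps from `x` to `x + z` to the generator. -/
noncomputable def bond (p : ℤ → ℝ) (x z : ℤ) (f : Config → ℝ) (η : Config) : ℝ :=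
  p z * occ η x * (1 - occ η (x + z)) * (f (exchange η x (x + z)) - f η)

lemma bond_eq_zero_of_dependsOn {s : Set ℤ} (hf : DependsOn f s) {x z : ℤ} (hx : x ∉ s)
    (hz : x + z ∉ s) : bond p x z f = 0 := by
  funext η
  simp [bond, DependsOn.apply_exchange hf hx hz]

lemma dependsOn_bond {s : Set ℤ} (hf : DependsOn f s) {x z : ℤ} (hx : x ∈ s)
    (hz : x + z ∈ s) : DependsOn (bond p x z f) s := by
  intro η ξ h
  have h1 := DependsOn.comp_exchange hf hx hz h
  simp only at h1
  simp only [bond, h1, hf h, occ, h x hx, h _ hz]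

lemma bond_sub (x z : ℤ) : bond p x z (f - g) = bond p x z f - bond p x z g := by
  funext η
  simp only [bond, Pi.sub_apply]
  ring

lemma bond_add (x z : ℤ) : bond p x z (f + g) = bond p x z f + bond p x z g := by
  funext η
  simp only [bond, Pi.add_apply]
  ring

lemma bond_smul (x z : ℤ) (c : ℝ) : bond p x z (c • f) = c • bond p x z f := by
  funext η
  simp only [bond, Pi.smul_apply, smul_eq_mul]
  ring

lemma IsLocal.bond (hf : IsLocal f) (x z : ℤ) : IsLocal (bond p x z f) := by
  have h1 : IsLocal fun η => p z * occ η x := (isLocal_const (p z)).mul (isLocal_occ x)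
  have h2 : IsLocal fun η => 1 - occ η (x + z) := (isLocal_const 1).sub (isLocal_occ (x + z))
  exact (h1.mul h2).mul ((hf.comp_reindex (Equiv.swap x (x + z))).sub hf)

lemma IsJumpLaw.summable (hp : IsJumpLaw p) : Summable p := by
  by_contra h
  have := hp.sum_one
  rw [tsum_eq_zero_of_not_summable h] at this
  norm_num at this

lemma IsJumpLaw.le_one (hp : IsJumpLaw p) (z : ℤ) : p z ≤ 1 := by
  rw [← hp.sum_one]
  exact hp.summable.le_tsum z fun _ _ => hp.nonneg _

lemma notMem_coe_Icc {a b x : ℤ} (h : x < a ∨ b < x) : x ∉ (Finset.Icc a b : Set ℤ) := by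
  rw [Finset.coe_Icc, Set.mem_Icc]
  omega

lemma mem_coe_Icc {a b x : ℤ} (h : a ≤ x ∧ x ≤ b) : x ∈ (Finset.Icc a b : Set ℤ) := by
  rwa [Finset.coe_Icc, Set.mem_Icc]

/-- On local functions the generator is a finite sum. -/
lemma generator_eq_sum (hR : ∀ z : ℤ, (R : ℤ) < |z| → p z = 0)
    (hf : DependsOn f (Finset.Icc (-k : ℤ) k : Set ℤ)) {M : ℕ} (hM : k + R ≤ M) :
    generator p f = ∑ x ∈ Finset.Icc (-M : ℤ) M, ∑ z ∈ Finset.Icc (-R : ℤ) R, bond p x z f := by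
  funext η
  have h1 : ∀ x : ℤ, ∑' z : ℤ, bond p x z f η = ∑ z ∈ Finset.Icc (-R : ℤ) R, bond p x z f η := by
    intro x
    refine tsum_eq_sum fun z hz => ?_
    have : p z = 0 := hR z (by rw [Finset.mem_Icc] at hz; rw [lt_abs]; omega)
    simp [bond, this]
  have h2 : ∑' x : ℤ, ∑ z ∈ Finset.Icc (-R : ℤ) R, bond p x z f η =
      ∑ x ∈ Finset.Icc (-M : ℤ) M, ∑ z ∈ Finset.Icc (-R : ℤ) R, bond p x z f η := by
    refine tsum_eq_sum fun x hx => Finset.sum_eq_zero fun z hz => ?_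
    rw [Finset.mem_Icc] at hx hz
    rw [bond_eq_zero_of_dependsOn hf (notMem_coe_Icc (by omega)) (notMem_coe_Icc (by omega))]
    rfl
  change ∑' x : ℤ, ∑' z : ℤ, bond p x z f η = _
  simp only [h1, h2, Finset.sum_apply]

lemma IsLocal.generator (hp : IsJumpLaw p) (hf : IsLocal f) : IsLocal (generator p f) := by
  obtain ⟨R, hR⟩ := hp.finiteRange
  obtain ⟨k, hk⟩ := hf.exists_mem_localIcc
  rw [generator_eq_sum hR hk le_rfl]
  exact isLocal_sum _ fun x _ => isLocal_sum _ fun z _ => hf.bond x z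

lemma generator_add (hp : IsJumpLaw p) (hf : IsLocal f) (hg : IsLocal g) :
    generator p (f + g) = generator p f + generator p g := by
  obtain ⟨R, hR⟩ := hp.finiteRange
  obtain ⟨k, hk⟩ := hf.exists_mem_localIcc
  obtain ⟨l, hl⟩ := hg.exists_mem_localIcc
  have hk' := localIcc_mono (le_max_left k l) (show (⟨f, hf⟩ : localFun) ∈ _ from hk)
  have hl' := localIcc_mono (le_max_right k l) (show (⟨g, hg⟩ : localFun) ∈ _ from hl)
  have hs : DependsOn (f + g) _ := mem_localIcc.mp (add_mem hk' hl')
  rw [generator_eq_sum hR hs le_rfl, generator_eq_sum hR hk' le_rfl,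
    generator_eq_sum hR hl' le_rfl]
  simp only [bond_add, Finset.sum_add_distrib]

lemma generator_smul (hp : IsJumpLaw p) (hf : IsLocal f) (c : ℝ) :
    generator p (c • f) = c • generator p f := by
  obtain ⟨R, hR⟩ := hp.finiteRange
  obtain ⟨k, hk⟩ := hf.exists_mem_localIcc
  have hs : DependsOn (c • f) (Finset.Icc (-k : ℤ) k : Set ℤ) :=
    (localIcc k).smul_mem c (show (⟨f, hf⟩ : localFun) ∈ _ from hk)
  rw [generator_eq_sum hR hs le_rfl, generator_eq_sum hR hk le_rfl]
  simp only [bond_smul, Finset.smul_sum]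

/-- The generator on local functions, with values in `L²`. -/
noncomputable def genToLp (hp : IsJumpLaw p) (ρ : unitInterval) :
    localFun →ₗ[ℝ] Lp ℝ 2 (bernoulliProd ρ) where
  toFun f := localToLp ρ ⟨generator p f.1, IsLocal.generator hp f.2⟩
  map_add' f g := by
    rw [← map_add]
    exact congrArg _ (Subtype.ext (generator_add hp f.2 g.2))
  map_smul' c f := by
    rw [RingHom.id_apply, ← map_smul]
    exact congrArg _ (Subtype.ext (generator_smul hp f.2 c))

lemma genToLp_apply (hp : IsJumpLaw p) (f : localFun) :
    genToLp hp ρ f = localToLp ρ ⟨generator p f.1, IsLocal.generator hp f.2⟩ := rfl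

lemma norm_toLp_mono (hf : MemLp f 2 (bernoulliProd ρ)) (hg : MemLp g 2 (bernoulliProd ρ))
    (h : ∀ η, |f η| ≤ |g η|) : ‖hf.toLp f‖ ≤ ‖hg.toLp g‖ := by
  refine Lp.norm_le_norm_of_ae_le ?_
  filter_upwards [hf.coeFn_toLp, hg.coeFn_toLp] with η h1 h2
  rw [h1, h2]
  exact h η

lemma MemLp.reindex (hf : MemLp f 2 (bernoulliProd ρ)) (σ : Equiv.Perm ℤ) :
    MemLp (fun η => f (reindex σ η)) 2 (bernoulliProd ρ) :=
  hf.comp_measurePreserving (measurePreserving_reindex ρ σ)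

lemma norm_toLp_reindex (hf : MemLp f 2 (bernoulliProd ρ)) (σ : Equiv.Perm ℤ) :
    ‖(MemLp.reindex hf σ).toLp _‖ = ‖hf.toLp f‖ := by
  rw [Lp.norm_toLp, Lp.norm_toLp]
  congr 1
  exact eLpNorm_comp_measurePreserving hf.1 (measurePreserving_reindex ρ σ)

lemma norm_bond_le (hp : IsJumpLaw p) (f : localFun) (x z : ℤ) :
    ‖localToLp ρ ⟨bond p x z f.1, IsLocal.bond f.2 x z⟩‖ ≤ 2 * ‖localToLp ρ f‖ := by
  have hf : MemLp f.1 2 (bernoulliProd ρ) := IsLocal.memLp f.2 2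
  have hf' := MemLp.reindex hf (Equiv.swap x (x + z))
  calc _ ≤ ‖(hf'.sub hf).toLp _‖ := by
        refine norm_toLp_mono (IsLocal.memLp (IsLocal.bond f.2 x z) 2) _ fun η => ?_
        change |p z * occ η x * (1 - occ η (x + z)) * (f.1 (exchange η x (x + z)) - f.1 η)| ≤
          |f.1 (exchange η x (x + z)) - f.1 η|
        rw [abs_mul]
        refine mul_le_of_le_one_left (abs_nonneg _) ?_
        have h1 := occ_nonneg η x
        have h2 := occ_le_one η x
        have h3 := occ_nonneg η (x + z)
        have h4 := occ_le_one η (x + z)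
        have h5 : 0 ≤ 1 - occ η (x + z) := by linarith
        have h6 := hp.nonneg z
        rw [abs_of_nonneg (by positivity)]
        exact mul_le_one₀ (mul_le_one₀ (hp.le_one z) h1 h2) h5 (by linarith)
    _ = ‖hf'.toLp _ - hf.toLp _‖ := rfl
    _ ≤ ‖hf'.toLp _‖ + ‖hf.toLp _‖ := norm_sub_le _ _
    _ = _ := by rw [norm_toLp_reindex hf, localToLp_apply, two_mul]

/-- Jumps starting in [−(k − R), k − R] stay inside [−k, k] and give `a`; the others give `b`. A
jump of the second kind has both ends outside [−(k − 2R), k − 2R], so it does not see `g`. This is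
why the range is 2R. -/
lemma generator_split (hp : IsJumpLaw p) (hR : ∀ z : ℤ, (R : ℤ) < |z| → p z = 0) (k : ℕ)
    (f : localFun) (hf : f ∈ localIcc k) :
    ∃ a ∈ localIcc k, ∃ b ∈ localIcc (k + 2 * R),
      genToLp hp ρ f = localToLp ρ a + localToLp ρ b ∧
      ∀ j, j + 2 * R ≤ k → ∀ g ∈ localIcc j,
        ‖localToLp ρ b‖ ≤ ((4 * R + 1) * (2 * R + 1) * 2 : ℝ) * ‖localToLp ρ f - localToLp ρ g‖ := by
  set J : Finset ℤ := Finset.Icc (-R : ℤ) R with hJ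
  set I : Finset ℤ := Finset.Icc (-(k - R) : ℤ) (k - R) with hI
  set W : Finset ℤ := Finset.Icc (-((k + R : ℕ) : ℤ)) ((k + R : ℕ) : ℤ) with hW
  have hIW : I ⊆ W := Finset.Icc_subset_Icc (by push_cast; omega) (by push_cast; omega)
  let β : ℤ → ℤ → localFun → localFun := fun x z f => ⟨bond p x z f.1, IsLocal.bond f.2 x z⟩
  refine ⟨∑ x ∈ I, ∑ z ∈ J, β x z f, ?_, ∑ x ∈ W \ I, ∑ z ∈ J, β x z f, ?_, ?_, ?_⟩
  · refine sum_mem fun x hx => sum_mem fun z hz => ?_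
    simp only [hI, hJ, Finset.mem_Icc] at hx hz
    exact dependsOn_bond hf (mem_coe_Icc (by omega)) (mem_coe_Icc (by omega))
  · refine sum_mem fun x hx => sum_mem fun z hz => ?_
    simp only [hW, hJ, Finset.mem_Icc, Finset.mem_sdiff] at hx hz
    exact dependsOn_bond (localIcc_mono (show k ≤ k + 2 * R by omega) hf)
      (mem_coe_Icc (by omega)) (mem_coe_Icc (by omega))
  · rw [← map_add, add_comm, Finset.sum_sdiff hIW, genToLp_apply]
    congr 1
    refine Subtype.ext ?_
    simp only [AddSubmonoidClass.coe_finsetSum]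
    exact generator_eq_sum hR hf le_rfl
  · intro j hj g hg
    have h1 : ∑ x ∈ W \ I, ∑ z ∈ J, β x z f = ∑ x ∈ W \ I, ∑ z ∈ J, β x z (f - g) := by
      refine Finset.sum_congr rfl fun x hx => Finset.sum_congr rfl fun z hz => Subtype.ext ?_
      simp only [hW, hJ, hI, Finset.mem_Icc, Finset.mem_sdiff] at hx hz
      change bond p x z f.1 = bond p x z (f.1 - g.1)
      rw [bond_sub, bond_eq_zero_of_dependsOn hg (notMem_coe_Icc (by omega))
        (notMem_coe_Icc (by omega)), sub_zero]
    rw [h1, map_sum, ← map_sub]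
    have hJc : (J.card : ℝ) = 2 * R + 1 := by
      have : J.card = 2 * R + 1 := by rw [hJ, Int.card_Icc]; omega
      exact_mod_cast this
    -- There are 4R boundary sites if k ≥ R; otherwise `I` is empty and `W` has at most 4R − 1
    -- sites.
    have hWc : ((W \ I).card : ℝ) ≤ 4 * R + 1 := by
      have : (W \ I).card ≤ 4 * R + 1 := by
        rw [Finset.card_sdiff_of_subset hIW, hW, hI, Int.card_Icc, Int.card_Icc]
        omega
      exact_mod_cast this
    refine (norm_sum_le _ _).trans ?_
    calc _ ≤ ∑ x ∈ W \ I, ((2 * R + 1) * (2 * ‖localToLp ρ (f - g)‖) : ℝ) := by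
          refine Finset.sum_le_sum fun x _ => ?_
          rw [map_sum]
          refine (norm_sum_le _ _).trans ?_
          calc _ ≤ ∑ z ∈ J, 2 * ‖localToLp ρ (f - g)‖ :=
                Finset.sum_le_sum fun z _ => norm_bond_le hp _ x z
            _ = _ := by rw [Finset.sum_const, nsmul_eq_mul, hJc]
      _ = (W \ I).card * ((2 * R + 1) * (2 * ‖localToLp ρ (f - g)‖) : ℝ) := by
          rw [Finset.sum_const, nsmul_eq_mul]
      _ ≤ (4 * R + 1) * ((2 * R + 1) * (2 * ‖localToLp ρ (f - g)‖) : ℝ) := by gcongr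
      _ = _ := by ring

end Generator

/-! ### The Dirichlet form -/

section Dirichlet

variable {p : ℤ → ℝ} {ρ : unitInterval} {f g : Config → ℝ} {R k : ℕ}

/-- The Dirichlet energy of the exchange of the sites `x` and `y`. -/
noncomputable def energy (ρ : unitInterval) (x y : ℤ) (f : Config → ℝ) : ℝ :=
  ∫ η, (f (exchange η x y) - f η) ^ 2 ∂(bernoulliProd ρ)

lemma energy_nonneg (x y : ℤ) : 0 ≤ energy ρ x y f := integral_nonneg fun _ => sq_nonneg _

lemma energy_eq_zero_of_dependsOn {s : Set ℤ} (hf : DependsOn f s) {x y : ℤ} (hx : x ∉ s)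
    (hy : y ∉ s) : energy ρ x y f = 0 := by
  simp [energy, DependsOn.apply_exchange hf hx hy]

/-- The Dirichlet energy of all exchanges over the distance `d`. -/
noncomputable def totalEnergy (ρ : unitInterval) (d : ℤ) (f : Config → ℝ) : ℝ :=
  ∑' x : ℤ, energy ρ x (x + d) f

lemma totalEnergy_nonneg (d : ℤ) : 0 ≤ totalEnergy ρ d f := tsum_nonneg fun _ => energy_nonneg _ _

lemma summable_energy (hf : IsLocal f) (a b : ℤ) :
    Summable fun x : ℤ => energy ρ (x + a) (x + b) f := by
  obtain ⟨A, hA⟩ := hf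
  refine summable_of_ne_finset_zero (s := A.image (· - a) ∪ A.image (· - b)) fun x hx => ?_
  simp only [Finset.mem_union, Finset.mem_image, not_or, not_exists, not_and] at hx
  refine energy_eq_zero_of_dependsOn hA (fun h => hx.1 _ h (by ring)) fun h => hx.2 _ h (by ring)

lemma tsum_energy (a b : ℤ) :
    ∑' x : ℤ, energy ρ (x + a) (x + b) f = totalEnergy ρ (b - a) f := by
  rw [totalEnergy, ← (Equiv.addRight a).tsum_eq fun x => energy ρ x (x + (b - a)) f]
  refine tsum_congr fun x => ?_
  simp only [Equiv.coe_addRight]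
  congr 1
  ring

lemma occ_exchange_left (η : Config) (x y : ℤ) : occ (exchange η x y) x = occ η y := by
  simp [occ, exchange]

lemma occ_exchange_right (η : Config) (x y : ℤ) : occ (exchange η x y) y = occ η x := by
  simp [occ, exchange]

/-- The exchange changes the configuration only if exactly one of the two sites is occupied, and
then the bracket is 1. -/
lemma exchange_rate_identity (η : Config) (x y : ℤ) :
    (occ η x * (1 - occ η y) + occ η y * (1 - occ η x)) * (f (exchange η x y) - f η) ^ 2 =
      (f (exchange η x y) - f η) ^ 2 := by
  by_cases h : η x = η y
  · have : exchange η x y = η := by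
      funext u
      simp only [exchange]
      rcases eq_or_ne u x with rfl | hx
      · simp [h]
      rcases eq_or_ne u y with rfl | hy
      · simp [h]
      rw [Equiv.swap_apply_of_ne_of_ne hx hy]
    simp [this]
  · have : occ η x * (1 - occ η y) + occ η y * (1 - occ η x) = 1 := by
      unfold occ
      cases h1 : η x <;> cases h2 : η y <;> simp_all
    rw [this, one_mul]

lemma integral_exchange (x y : ℤ) (hf : IsLocal f) :
    ∫ η, f (exchange η x y) ∂(bernoulliProd ρ) = ∫ η, f η ∂(bernoulliProd ρ) :=
  integral_reindex (Equiv.swap x y) hf.measurable.aestronglyMeasurable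

/-- The second moment of `f` weighted with the occupation variable at `x`. -/
noncomputable def occMoment (ρ : unitInterval) (f : Config → ℝ) (x : ℤ) : ℝ :=
  ∫ η, occ η x * f η ^ 2 ∂(bernoulliProd ρ)

/-- Use u(v − u) = ½(v² − u² − (v − u)²) and the invariance of the measure under exchanges. The
first two squares leave a difference of occupation moments; for the last one, both directions of the
jump contribute equally, each half of the energy, whence 1/4. -/
lemma integral_bond (hf : IsLocal f) (x z : ℤ) :
    inner2 ρ f (bond p x z f) = p z * (1 / 2 * (occMoment ρ f (x + z) - occMoment ρ f x)
      - 1 / 4 * energy ρ x (x + z) f) := by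
  set y := x + z with hy
  have hox := isLocal_occ x
  have hoy := isLocal_occ y
  have hone := isLocal_const 1
  have hfe : IsLocal fun η => f (exchange η x y) := hf.comp_reindex (Equiv.swap x y)
  have hd : IsLocal fun η => (f (exchange η x y) - f η) ^ 2 := hfe.binary hf fun a b => (a - b) ^ 2
  have hsq : IsLocal fun η => f η ^ 2 := hf.binary hf fun a _ => a ^ 2
  have hsqe : IsLocal fun η => f (exchange η x y) ^ 2 := hfe.binary hf fun a _ => a ^ 2
  have ha : IsLocal fun η => occ η x * (1 - occ η y) := hox.mul (hone.sub hoy)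
  have ha' : IsLocal fun η => occ η y * (1 - occ η x) := hoy.mul (hone.sub hox)
  have m1 : IsLocal fun η => occ η x * (1 - occ η y) * f (exchange η x y) ^ 2 := ha.mul hsqe
  have m2 : IsLocal fun η => occ η x * (1 - occ η y) * f η ^ 2 := ha.mul hsq
  have m3 : IsLocal fun η => occ η y * (1 - occ η x) * f η ^ 2 := ha'.mul hsq
  have m4 : IsLocal fun η => occ η x * (1 - occ η y) * (f (exchange η x y) - f η) ^ 2 :=
    ha.mul hd
  have m5 : IsLocal fun η => occ η y * (1 - occ η x) * (f (exchange η x y) - f η) ^ 2 :=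
    ha'.mul hd
  have m6 : IsLocal fun η => occ η x * f η ^ 2 := hox.mul hsq
  have m7 : IsLocal fun η => occ η y * f η ^ 2 := hoy.mul hsq
  have m8 : IsLocal fun η => occ η x * (1 - occ η y) * f (exchange η x y) ^ 2 -
      occ η x * (1 - occ η y) * f η ^ 2 := m1.sub m2
  have i1 : ∫ η, occ η x * (1 - occ η y) * f (exchange η x y) ^ 2 ∂(bernoulliProd ρ) =
      ∫ η, occ η y * (1 - occ η x) * f η ^ 2 ∂(bernoulliProd ρ) := by
    rw [← integral_exchange x y m3]
    simp only [occ_exchange_left, occ_exchange_right]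
  have i2 : ∫ η, occ η y * (1 - occ η x) * (f (exchange η x y) - f η) ^ 2 ∂(bernoulliProd ρ) =
      ∫ η, occ η x * (1 - occ η y) * (f (exchange η x y) - f η) ^ 2 ∂(bernoulliProd ρ) := by
    rw [← integral_exchange x y m4]
    simp only [occ_exchange_left, occ_exchange_right, exchange_exchange]
    refine integral_congr_ae (Eventually.of_forall fun η => ?_)
    simp only
    ring
  have i3 : ∫ η, occ η x * (1 - occ η y) * (f (exchange η x y) - f η) ^ 2 ∂(bernoulliProd ρ) +
      ∫ η, occ η y * (1 - occ η x) * (f (exchange η x y) - f η) ^ 2 ∂(bernoulliProd ρ) =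
      energy ρ x y f := by
    rw [← integral_add m4.integrable m5.integrable, energy]
    refine integral_congr_ae (Eventually.of_forall fun η => ?_)
    simp only
    rw [← add_mul, exchange_rate_identity]
  have i4 : ∫ η, occ η y * (1 - occ η x) * f η ^ 2 ∂(bernoulliProd ρ) -
      ∫ η, occ η x * (1 - occ η y) * f η ^ 2 ∂(bernoulliProd ρ) =
      occMoment ρ f y - occMoment ρ f x := by
    rw [← integral_sub m3.integrable m2.integrable, occMoment, occMoment,
      ← integral_sub m7.integrable m6.integrable]
    refine integral_congr_ae (Eventually.of_forall fun η => ?_)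
    simp only
    ring
  have i5 : inner2 ρ f (bond p x z f) = p z * (1 / 2 *
      ((∫ η, occ η x * (1 - occ η y) * f (exchange η x y) ^ 2 ∂(bernoulliProd ρ)) -
      (∫ η, occ η x * (1 - occ η y) * f η ^ 2 ∂(bernoulliProd ρ)) -
      ∫ η, occ η x * (1 - occ η y) * (f (exchange η x y) - f η) ^ 2 ∂(bernoulliProd ρ))) := by
    rw [← integral_sub m1.integrable m2.integrable,
      ← integral_sub m8.integrable m4.integrable,
      ← integral_const_mul, ← integral_const_mul]
    refine integral_congr_ae (Eventually.of_forall fun η => ?_)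
    simp only [bond]
    ring
  rw [i5]
  congr 1
  linarith

/-- The Bernoulli measure is invariant under the total drift of the particles. -/
lemma sum_occMoment_shift (hf : IsLocal f) (hk : DependsOn f (Finset.Icc (-k : ℤ) k : Set ℤ))
    {M : ℕ} {z : ℤ} (hz : |z| ≤ R) (hM : k + R ≤ M) :
    ∑ x ∈ Finset.Icc (-M : ℤ) M, (occMoment ρ f (x + z) - occMoment ρ f x) = 0 := by
  set c := occMoment ρ f (k + 1) with hc
  -- Outside the support of `f` all sites are exchangeable, so the moment equals its value at k + 1.
  -- Subtracting this constant makes the shifted sums finite and equal.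
  have hout : ∀ x ∉ Finset.Icc (-k : ℤ) k, occMoment ρ f x - c = 0 := by
    intro x hx
    have h1 : IsLocal fun η => occ η x * f η ^ 2 :=
      (isLocal_occ x).binary hf fun a b => a * b ^ 2
    have h2 := integral_exchange (ρ := ρ) x (k + 1) h1
    rw [sub_eq_zero, hc, occMoment, occMoment, ← h2]
    refine integral_congr_ae (Eventually.of_forall fun η => ?_)
    simp only
    rw [occ_exchange_left, DependsOn.apply_exchange hk (by exact_mod_cast hx)
      (notMem_coe_Icc (by omega))]
  have h1 : ∑ x ∈ Finset.Icc (-M : ℤ) M, (occMoment ρ f x - c) =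
      ∑ x ∈ Finset.Icc (-k : ℤ) k, (occMoment ρ f x - c) := by
    symm
    exact Finset.sum_subset (Finset.Icc_subset_Icc (by omega) (by omega)) fun x _ hx => hout x hx
  have h2 : ∑ x ∈ Finset.Icc (-M : ℤ) M, (occMoment ρ f (x + z) - c) =
      ∑ x ∈ Finset.Icc (-k : ℤ) k, (occMoment ρ f x - c) := by
    have h3 := Finset.sum_map (Finset.Icc (-M : ℤ) M) (addRightEmbedding z)
      (fun x => occMoment ρ f x - c)
    simp only [addRightEmbedding_apply, Finset.map_add_right_Icc] at h3
    rw [← h3]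
    rw [abs_le] at hz
    symm
    exact Finset.sum_subset (Finset.Icc_subset_Icc (by omega) (by omega)) fun x _ hx => hout x hx
  rw [← sub_eq_zero.mpr (h2.trans h1.symm), ← Finset.sum_sub_distrib]
  exact Finset.sum_congr rfl fun x _ => by ring

lemma inner2_sum {α : Type*} (s : Finset α) {F : α → Config → ℝ} (hf : IsLocal f)
    (h : ∀ i ∈ s, IsLocal (F i)) : inner2 ρ f (∑ i ∈ s, F i) = ∑ i ∈ s, inner2 ρ f (F i) := by
  simp only [inner2, Finset.sum_apply, Finset.mul_sum]
  exact integral_finsetSum _ fun i hi => (hf.mul (h i hi)).integrable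

/-- The Dirichlet form of the generator. -/
lemma inner2_generator (hR : ∀ z : ℤ, (R : ℤ) < |z| → p z = 0) (hf : IsLocal f) :
    inner2 ρ f (generator p f) =
      -(1 / 4 * ∑ z ∈ Finset.Icc (-R : ℤ) R, p z * totalEnergy ρ z f) := by
  obtain ⟨k, hk⟩ := hf.exists_mem_localIcc
  rw [generator_eq_sum hR hk le_rfl, inner2_sum _ hf
    fun x _ => isLocal_sum _ fun z _ => hf.bond x z]
  simp only [inner2_sum _ hf fun z _ => hf.bond _ z, integral_bond hf]
  rw [Finset.sum_comm, Finset.mul_sum, ← Finset.sum_neg_distrib]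
  refine Finset.sum_congr rfl fun z hz => ?_
  rw [Finset.mem_Icc] at hz
  have h1 := sum_occMoment_shift (ρ := ρ) hf hk (abs_le.mpr hz) le_rfl
  have h2 : totalEnergy ρ z f =
      ∑ x ∈ Finset.Icc (-((k + R : ℕ) : ℤ)) ((k + R : ℕ) : ℤ), energy ρ x (x + z) f := by
    refine tsum_eq_sum fun x hx => ?_
    rw [Finset.mem_Icc] at hx
    exact energy_eq_zero_of_dependsOn hk (notMem_coe_Icc (by omega)) (notMem_coe_Icc (by omega))
  rw [← Finset.mul_sum, Finset.sum_sub_distrib, ← Finset.mul_sum, ← Finset.mul_sum, h1, ← h2]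
  ring

lemma isFiniteRangeDissipative_generator (hp : IsJumpLaw p)
    (hR : ∀ z : ℤ, (R : ℤ) < |z| → p z = 0) :
    IsFiniteRangeDissipative (localToLp ρ) (genToLp hp ρ) localIcc (2 * R)
      ((4 * R + 1) * (2 * R + 1) * 2) where
  mono := localIcc_mono
  dissip f := by
    rw [genToLp_apply, localToLp_apply, localToLp_apply, inner_toLp, inner2_generator hR f.2]
    have : 0 ≤ ∑ z ∈ Finset.Icc (-R : ℤ) R, p z * totalEnergy ρ z f.1 :=
      Finset.sum_nonneg fun z _ => mul_nonneg (hp.nonneg z) (totalEnergy_nonneg z)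
    linarith
  split k f hf := generator_split hp hR k f hf
  finite k := by
    have := finiteDimensional_localIcc k
    infer_instance
  dense := dense_localIcc

end Dirichlet

/-! ### Independence and translations -/

section Independence

variable {ρ : unitInterval} {f g : Config → ℝ}

/-- Local functions of disjoint sets of sites are independent. -/
lemma integral_mul_of_disjoint {A B : Finset ℤ} (hAB : Disjoint A B)
    (hf : DependsOn f (A : Set ℤ)) (hg : DependsOn g (B : Set ℤ)) :
    ∫ η, f η * g η ∂(bernoulliProd ρ) =
      (∫ η, f η ∂(bernoulliProd ρ)) * ∫ η, g η ∂(bernoulliProd ρ) := by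
  have hi : iIndepFun (fun (i : ℤ) (η : Config) => η i) (bernoulliProd ρ) :=
    iIndepFun_infinitePi (P := fun _ : ℤ => bernoulliMeasure true false ρ)
      (X := fun _ b => b) fun _ => measurable_id
  have h1 := hi.indepFun_finset A B hAB fun i => measurable_pi_apply i
  obtain ⟨F, hF⟩ := dependsOn_iff_exists_comp.mp hf
  obtain ⟨G, hG⟩ := dependsOn_iff_exists_comp.mp hg
  have h2 : IndepFun f g (bernoulliProd ρ) := by
    rw [hF, hG]
    exact h1.comp (φ := F) (ψ := G) (measurable_of_countable _) (measurable_of_countable _)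
  exact h2.integral_fun_mul_eq_mul_integral
    (IsLocal.of_dependsOn hf).measurable.aestronglyMeasurable
    (IsLocal.of_dependsOn hg).measurable.aestronglyMeasurable

end Independence

section Translation

variable {p : ℤ → ℝ} {ρ : unitInterval} {f g : Config → ℝ}

lemma IsLocal.translate (hf : IsLocal f) (x : ℤ) : IsLocal (translate x f) :=
  hf.comp_reindex (Equiv.addLeft x)

lemma MemLp.translate (hf : MemLp f 2 (bernoulliProd ρ)) (x : ℤ) :
    MemLp (translate x f) 2 (bernoulliProd ρ) :=
  MemLp.reindex hf (Equiv.addLeft x)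

lemma eLpNorm_translate (hf : AEStronglyMeasurable f (bernoulliProd ρ)) (x : ℤ) :
    eLpNorm (translate x f) 2 (bernoulliProd ρ) = eLpNorm f 2 (bernoulliProd ρ) :=
  eLpNorm_comp_measurePreserving hf (measurePreserving_reindex ρ (Equiv.addLeft x))

lemma translate_translate (x y : ℤ) (f : Config → ℝ) :
    translate x (translate y f) = translate (x + y) f := by
  funext η
  refine congrArg f (funext fun u => ?_)
  simp [shift, add_assoc]

lemma inner2_translate (hf : MemLp f 2 (bernoulliProd ρ)) (hg : MemLp g 2 (bernoulliProd ρ))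
    (x y : ℤ) : inner2 ρ (translate x f) (translate y g) = inner2 ρ f (translate (y - x) g) := by
  have h1 : translate y g = translate x (translate (y - x) g) := by
    rw [translate_translate, add_sub_cancel]
  rw [h1]
  exact integral_reindex (Equiv.addLeft x) (hf.1.mul (MemLp.translate hg (y - x)).1)

lemma shift_exchange (x y w : ℤ) (η : Config) :
    shift x (exchange η (x + y) (x + w)) = exchange (shift x η) y w := by
  funext u
  simp only [shift, exchange]
  congr 1
  rcases eq_or_ne u y with rfl | h1
  · simp
  rcases eq_or_ne u w with rfl | h2
  · simp
  rw [Equiv.swap_apply_of_ne_of_ne h1 h2, Equiv.swap_apply_of_ne_of_ne] <;> simpa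

lemma generator_translate (x : ℤ) (f : Config → ℝ) :
    generator p (translate x f) = translate x (generator p f) := by
  funext η
  change _ = generator p f (shift x η)
  unfold generator
  rw [← (Equiv.addLeft x).tsum_eq]
  refine tsum_congr fun y => tsum_congr fun z => ?_
  simp only [Equiv.coe_addLeft, translate, add_assoc, shift_exchange]
  rfl

lemma IsClosedGenerator.translate (h : IsClosedGenerator p ρ f g)
    (hp : IsJumpLaw p) (x : ℤ) : IsClosedGenerator p ρ (translate x f) (translate x g) := by
  obtain ⟨hf, hg, F, hF, h1, h2⟩ := h
  refine ⟨MemLp.translate hf x, MemLp.translate hg x, fun n => AEP.translate x (F n),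
    fun n => (hF n).translate x, ?_, ?_⟩
  · refine h1.congr fun n => ?_
    rw [← eLpNorm_translate (((hF n).memLp 2).sub hf).1 x]
    rfl
  · refine h2.congr fun n => ?_
    rw [← eLpNorm_translate ((((hF n).generator hp).memLp 2).sub hg).1 x, generator_translate]
    rfl

end Translation

/-! ### Resolvents of the exclusion process -/

section Resolvent

variable {p : ℤ → ℝ} {ρ : unitInterval} {f g φ ψ : Config → ℝ} {lam : ℝ}

lemma isClosedGenerator_iff (hp : IsJumpLaw p) (hf : MemLp f 2 (bernoulliProd ρ))
    (hg : MemLp g 2 (bernoulliProd ρ)) :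
    IsClosedGenerator p ρ f g ↔
      InClosure (localToLp ρ) (genToLp hp ρ) (hf.toLp f) (hg.toLp g) := by
  constructor
  · rintro ⟨-, -, F, hF, h1, h2⟩
    refine ⟨fun n => ⟨F n, hF n⟩, ?_, ?_⟩
    · exact (Lp.tendsto_Lp_iff_tendsto_eLpNorm'' F (fun n => (hF n).memLp 2) f hf).mpr h1
    · exact (Lp.tendsto_Lp_iff_tendsto_eLpNorm'' (fun n => generator p (F n))
        (fun n => ((hF n).generator hp).memLp 2) g hg).mpr h2
  · rintro ⟨F, h1, h2⟩
    refine ⟨hf, hg, fun n => (F n).1, fun n => (F n).2, ?_, ?_⟩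
    · exact (Lp.tendsto_Lp_iff_tendsto_eLpNorm'' (fun n => (F n).1)
        (fun n => IsLocal.memLp (F n).2 2) f hf).mp h1
    · exact (Lp.tendsto_Lp_iff_tendsto_eLpNorm'' (fun n => generator p (F n).1)
        (fun n => IsLocal.memLp (IsLocal.generator hp (F n).2) 2) g hg).mp h2

lemma IsResolvent.inClosure (h : IsResolvent p ρ lam φ ψ) (hp : IsJumpLaw p)
    (hφ : MemLp φ 2 (bernoulliProd ρ)) :
    InClosure (localToLp ρ) (genToLp hp ρ) (h.1.toLp ψ) (lam • h.1.toLp ψ - hφ.toLp φ) :=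
  (isClosedGenerator_iff hp h.1 ((h.1.const_smul lam).sub hφ)).mp h

lemma genToLp_dissip (hp : IsJumpLaw p) (f : localFun) :
    inner ℝ (localToLp ρ f) (genToLp hp ρ f) ≤ 0 := by
  obtain ⟨R, hR⟩ := hp.finiteRange
  exact (isFiniteRangeDissipative_generator hp hR).dissip f

/-- The resolvent exists and is unique. -/
lemma exists_unique_resolvent (hp : IsJumpLaw p) (hl : 0 < lam)
    (hφ : MemLp φ 2 (bernoulliProd ρ)) :
    ∃ ψ, IsResolvent p ρ lam φ ψ ∧ ∀ ψ', IsResolvent p ρ lam φ ψ' → ψ' =ᵐ[bernoulliProd ρ] ψ := by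
  obtain ⟨R, hR⟩ := hp.finiteRange
  obtain ⟨u, hu⟩ := (isFiniteRangeDissipative_generator (ρ := ρ) hp hR).exists_resolvent hl
    (hφ.toLp φ)
  have hum : MemLp u 2 (bernoulliProd ρ) := Lp.memLp u
  have hres : IsResolvent p ρ lam φ u := by
    refine (isClosedGenerator_iff hp hum ((hum.const_smul lam).sub hφ)).mpr ?_
    rw [MemLp.toLp_sub (hum.const_smul lam) hφ, MemLp.toLp_const_smul lam hum, Lp.toLp_coeFn]
    exact hu
  refine ⟨u, hres, fun ψ' h' => ?_⟩
  have := InClosure.resolvent_unique (genToLp_dissip hp) hl (hres.inClosure hp hφ)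
    (h'.inClosure hp hφ)
  exact (MemLp.toLp_eq_toLp_iff h'.1 hres.1).mp this

lemma isResolvent_resolvent (hp : IsJumpLaw p) (hl : 0 < lam)
    (hφ : MemLp φ 2 (bernoulliProd ρ)) : IsResolvent p ρ lam φ (resolvent p ρ lam φ) :=
  Classical.epsilon_spec ((exists_unique_resolvent hp hl hφ).imp fun _ h => h.1)

lemma IsResolvent.translate (h : IsResolvent p ρ lam φ ψ) (hp : IsJumpLaw p) (x : ℤ) :
    IsResolvent p ρ lam (AEP.translate x φ) (AEP.translate x ψ) :=
  IsClosedGenerator.translate h hp x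

/-- The correlations between the resolvent and the translates of a centred local function are
summable. -/
lemma IsResolvent.summable (h : IsResolvent p ρ lam φ ψ) (hp : IsJumpLaw p) (hl : 0 < lam)
    (hφ : IsLocal φ) (h0 : ∫ η, φ η ∂(bernoulliProd ρ) = 0) :
    Summable fun x : ℤ => inner2 ρ φ (AEP.translate x ψ) := by
  obtain ⟨R, hR⟩ := hp.finiteRange
  obtain ⟨r, hr⟩ := hφ.exists_mem_localIcc
  have hT := isFiniteRangeDissipative_generator (ρ := ρ) hp hR
  set s := fun k => ‖h.1.toLp ψ - localProj (localToLp ρ) localIcc hT.finite k (h.1.toLp ψ)‖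
  have hs : Summable s := by
    refine hT.summable_resolvent_decay (by positivity) hl (r := r) (φ := (hφ.memLp 2).toLp φ)
      ⟨⟨φ, hφ⟩, hr, rfl⟩ (h.inClosure hp (hφ.memLp 2))
  have hc : ∀ x : ℤ, ∀ k : ℕ, (k + r < x ∨ k + r < -x) →
      ‖inner2 ρ φ (AEP.translate x ψ)‖ ≤ ‖(hφ.memLp (ρ := ρ) 2).toLp φ‖ * s k := by
    intro x k hx
    have hm := (hφ.translate (-x)).memLp (ρ := ρ) 2
    have h1 : inner2 ρ φ (AEP.translate x ψ) = inner ℝ (hm.toLp _) (h.1.toLp ψ) := by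
      have h2 := inner2_translate (hφ.memLp 2) h.1 (-x) 0
      rw [zero_sub, neg_neg] at h2
      rw [← h2, inner_toLp]
      congr 1
      funext η
      exact congrArg ψ (funext fun u => by simp [shift])
    have h3 : ‖hm.toLp _‖ = ‖(hφ.memLp 2).toLp φ‖ :=
      norm_toLp_reindex (hφ.memLp 2) (Equiv.addLeft (-x))
    rw [h1, ← h3, Real.norm_eq_abs]
    -- The translate of `φ` is centred and lives on sites outside [−k, k], hence is independent of,
    -- and orthogonal to, every function of the sites in [−k, k].
    refine abs_inner_le_of_orthogonal hT.finite k _ _ fun g hg => ?_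
    rw [localToLp_apply, inner_toLp]
    have hdep : DependsOn (AEP.translate (-x) φ)
        ((Finset.Icc (-r : ℤ) r).image (Equiv.addLeft (-x)) : Finset ℤ) := by
      rw [Finset.coe_image]
      exact DependsOn.comp_reindex hr (Equiv.addLeft (-x))
    have hz : ∫ η, AEP.translate (-x) φ η ∂(bernoulliProd ρ) = 0 := by
      rw [← h0]
      exact integral_reindex (Equiv.addLeft (-x)) hφ.measurable.aestronglyMeasurable
    rw [inner2, integral_mul_of_disjoint ?_ hdep hg, hz, zero_mul]
    rw [Finset.disjoint_left]
    intro u hu hu'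
    simp only [Finset.mem_image, Finset.mem_Icc, Equiv.coe_addLeft] at hu hu'
    obtain ⟨v, hv, rfl⟩ := hu
    omega
  refine Summable.of_nat_of_neg ?_ ?_
  -- At x = n + r + 1 the translate is just disjoint from [−n, n].
  · rw [← summable_nat_add_iff (r + 1)]
    refine Summable.of_norm_bounded (hs.mul_left _) fun n => hc _ n ?_
    left
    push_cast
    omega
  · rw [← summable_nat_add_iff (r + 1)]
    refine Summable.of_norm_bounded (hs.mul_left _) fun n => hc _ n ?_
    right
    push_cast
    omega

end Resolvent

/-! ### Averages of Toeplitz sums -/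

section Cesaro

/-- Enlarging the square from n to n + 1 adds one row, one column and the corner, that is, the
symmetric partial sum of `c` over |d| ≤ n. The average over the square is thus a Cesàro mean of
partial sums. -/
lemma sum_range_sum_range_sub (c : ℤ → ℝ) (N : ℕ) :
    ∑ x ∈ Finset.range N, ∑ y ∈ Finset.range N, c ((y : ℤ) - x) =
      ∑ n ∈ Finset.range N,
        (c 0 + ∑ i ∈ Finset.range n, (c (i + 1) + c (-(i + 1)))) := by
  induction N with
  | zero => simp
  | succ N ih =>
    rw [Finset.sum_range_succ _ N]
    simp only [Finset.sum_range_succ _ N]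
    rw [Finset.sum_add_distrib, ih, Finset.sum_add_distrib, sub_self]
    have h1 : ∑ x ∈ Finset.range N, c ((N : ℤ) - x) = ∑ i ∈ Finset.range N, c (i + 1) := by
      rw [← Finset.sum_range_reflect]
      refine Finset.sum_congr rfl fun i hi => ?_
      rw [Finset.mem_range] at hi
      congr 1
      omega
    have h2 : ∑ x ∈ Finset.range N, c ((x : ℤ) - N) = ∑ i ∈ Finset.range N, c (-(i + 1)) := by
      rw [← Finset.sum_range_reflect]
      refine Finset.sum_congr rfl fun i hi => ?_
      rw [Finset.mem_range] at hi
      congr 1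
      omega
    rw [h1, h2, Finset.sum_add_distrib (s := Finset.range N) (f := fun i : ℕ => c (i + 1))]
    ring

/-- Averages of Toeplitz sums converge to the sum of the coefficients. -/
lemma tendsto_toeplitz_average {c : ℤ → ℝ} (hc : Summable c) :
    Tendsto (fun N : ℕ => (N : ℝ)⁻¹ *
      ∑ x ∈ Finset.range N, ∑ y ∈ Finset.range N, c ((y : ℤ) - x)) atTop (𝓝 (∑' d, c d)) := by
  simp only [sum_range_sum_range_sub]
  refine Filter.Tendsto.cesaro ?_
  have h1 : Summable fun n : ℕ => c (n + 1) :=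
    hc.comp_injective (i := fun n : ℕ => (n + 1 : ℤ)) fun a b h => by simpa using h
  have h2 : Summable fun n : ℕ => c (-(n + 1)) :=
    hc.comp_injective (i := fun n : ℕ => (-(n + 1) : ℤ)) fun a b h => by simpa using h
  have h3 := (h1.hasSum.add h2.hasSum).tendsto_sum_nat.const_add (c 0)
  have h4 : ∑' d, c d = c 0 + ((∑' n : ℕ, c (n + 1)) + ∑' n : ℕ, c (-(n + 1))) := by
    rw [tsum_of_add_one_of_neg_add_one h1 h2]
    ring
  rw [h4]
  exact h3

end Cesaro

/-! ### From a variational bound to the norm -/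

section Bound

variable {p : ℤ → ℝ} {ρ : unitInterval} {φ : Config → ℝ} {lam K : ℝ}

/-- The hypothesis `hK` is a bound by duality on the sum of N translates, stated on the core of
local functions and linear in N so that it survives the averaging. -/
theorem normHm1_le (hp : IsJumpLaw p) (hl : 0 < lam) (hφ : IsLocal φ)
    (h0 : ∫ η, φ η ∂(bernoulliProd ρ) = 0) (hK0 : 0 ≤ K)
    (hK : ∀ N : ℕ, ∀ f, IsLocal f → (∑ x ∈ Finset.range N, inner2 ρ (translate x φ) f) ^ 2 ≤
      K * N * -inner2 ρ f (generator p f)) :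
    NormHm1WellDefined p ρ lam φ ∧ normHm1 p ρ lam φ ≤ √K := by
  have hφ2 := hφ.memLp (ρ := ρ) 2
  have hres := isResolvent_resolvent hp hl hφ2
  set ψ := resolvent p ρ lam φ with hψ
  have hsum := hres.summable hp hl hφ h0
  set Φ : ℕ → Lp ℝ 2 (bernoulliProd ρ) := fun N =>
    ∑ x ∈ Finset.range N, (MemLp.translate hφ2 x).toLp _
  set Ψ : ℕ → Lp ℝ 2 (bernoulliProd ρ) := fun N =>
    ∑ x ∈ Finset.range N, (MemLp.translate hres.1 x).toLp _
  have hcl : ∀ N, InClosure (localToLp ρ) (genToLp hp ρ) (Ψ N) (lam • Ψ N - Φ N) := by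
    intro N
    have h1 : lam • Ψ N - Φ N = ∑ x ∈ Finset.range N,
        (lam • (MemLp.translate hres.1 x).toLp _ - (MemLp.translate hφ2 x).toLp _) := by
      rw [Finset.sum_sub_distrib, Finset.smul_sum]
    rw [h1]
    exact InClosure.sum _ fun x _ => (hres.translate hp x).inClosure hp (MemLp.translate hφ2 x)
  have hinner : ∀ N, inner ℝ (Φ N) (Ψ N) = ∑ x ∈ Finset.range N, ∑ y ∈ Finset.range N,
      inner2 ρ φ (translate ((y : ℤ) - x) ψ) := by
    intro N
    simp only [Φ, Ψ, sum_inner, inner_sum, inner_toLp]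
    rw [Finset.sum_comm]
    exact Finset.sum_congr rfl fun x _ => Finset.sum_congr rfl fun y _ =>
      inner2_translate hφ2 hres.1 _ _
  have henergy : ∀ N, lam * ‖Ψ N‖ ^ 2 ≤ inner ℝ (Φ N) (Ψ N) := by
    intro N
    have := (hcl N).inner_nonpos (genToLp_dissip hp)
    rw [inner_sub_right, real_inner_smul_right, real_inner_self_eq_norm_sq,
      real_inner_comm] at this
    linarith
  have hnonneg : ∀ N, 0 ≤ inner ℝ (Φ N) (Ψ N) := fun N =>
    le_trans (by positivity) (henergy N)
  -- Let `f` run through local approximants of `Ψ N` in the graph norm. The Dirichlet form then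
  -- tends to ⟨Φ, Ψ⟩ − lam ‖Ψ‖², and the last term can be dropped.
  have hupper : ∀ N : ℕ, inner ℝ (Φ N) (Ψ N) ^ 2 ≤ K * N * inner ℝ (Φ N) (Ψ N) := by
    intro N
    obtain ⟨F, hF1, hF2⟩ := hcl N
    have l1 := (tendsto_const_nhds (x := Φ N)).inner (𝕜 := ℝ) hF1 |>.pow 2
    have l2 := ((hF1.inner (𝕜 := ℝ) hF2).neg).const_mul (K * N)
    have h1 := le_of_tendsto_of_tendsto l1 l2 (Eventually.of_forall fun n => by
      have := hK N (F n).1 (F n).2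
      simp only [Φ, sum_inner, genToLp_apply, localToLp_apply, inner_toLp]
      exact this)
    rw [inner_sub_right, real_inner_smul_right, real_inner_self_eq_norm_sq,
      real_inner_comm (Φ N) (Ψ N)] at h1
    have h2 : 0 ≤ K * N * (lam * ‖Ψ N‖ ^ 2) := by positivity
    linarith
  have hlim := tendsto_toeplitz_average hsum
  simp only [← hinner] at hlim
  have hpos : 0 ≤ innerSum ρ φ ψ :=
    ge_of_tendsto' hlim fun N => mul_nonneg (by positivity) (hnonneg N)
  have hle : innerSum ρ φ ψ ≤ K := by
    refine le_of_tendsto hlim (eventually_atTop.mpr ⟨1, fun N hN => ?_⟩)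
    have hN0 : (0 : ℝ) < N := by exact_mod_cast hN
    rw [inv_mul_le_iff₀ hN0]
    rcases (hnonneg N).eq_or_lt with h | h
    · rw [← h]
      positivity
    · have := hupper N
      rw [sq] at this
      have := le_of_mul_le_mul_right this h
      linarith
  exact ⟨⟨exists_unique_resolvent hp hl hφ2, hsum, hpos⟩, Real.sqrt_le_sqrt hle⟩

end Bound

/-! ### Comparison of exchange energies over different distances -/

section Comparison

variable {p : ℤ → ℝ} {ρ : unitInterval} {f : Config → ℝ}

lemma exchange_self (η : Config) (x : ℤ) : exchange η x x = η := by
  funext u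
  simp [exchange]

lemma energy_self (x : ℤ) : energy ρ x x f = 0 := by simp [energy, exchange_self]

lemma energy_comm (x y : ℤ) : energy ρ x y f = energy ρ y x f := by
  have h : ∀ η, exchange η x y = exchange η y x := fun η => by
    unfold exchange
    rw [Equiv.swap_comm]
  simp only [energy, h]

lemma exchange_triple (η : Config) {x y w : ℤ} (hxw : x ≠ w) (hyw : y ≠ w) :
    exchange (exchange (exchange η x y) y w) x y = exchange η x w := by
  funext u
  simp only [exchange]
  have h := Equiv.swap_mul_swap_mul_swap (x := w) (y := y) (z := x) hyw.symm hxw.symm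
  rw [Equiv.swap_comm y x, Equiv.swap_comm w y] at h
  rw [← h]
  rfl

/-- The exchange of x and w is that of y and w conjugated by that of x and y: three steps, two of
them over x, y. Telescope, apply Cauchy–Schwarz (the factor 3), and use that each intermediate
configuration again has the Bernoulli law. -/
lemma energy_triangle (hf : IsLocal f) (x y w : ℤ) :
    energy ρ x w f ≤ 3 * (2 * energy ρ x y f + energy ρ y w f) := by
  have n1 := energy_nonneg (ρ := ρ) (f := f) x y
  have n2 := energy_nonneg (ρ := ρ) (f := f) y w
  rcases eq_or_ne x w with rfl | hxw
  · rw [energy_self]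
    positivity
  rcases eq_or_ne y w with rfl | hyw
  · linarith
  have hl : ∀ a b, IsLocal fun η => (f (exchange η a b) - f η) ^ 2 := fun a b =>
    (hf.comp_reindex (Equiv.swap a b)).binary hf fun u v => (u - v) ^ 2
  have hl2 : IsLocal fun η =>
      (f (exchange (exchange η x y) y w) - f (exchange η x y)) ^ 2 :=
    (hl y w).comp_reindex (Equiv.swap x y)
  have hl3' : IsLocal fun η =>
      (f (exchange (exchange η y w) x y) - f (exchange η y w)) ^ 2 :=
    (hl x y).comp_reindex (Equiv.swap y w)
  have hl3 : IsLocal fun η =>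
      (f (exchange (exchange (exchange η x y) y w) x y) -
        f (exchange (exchange η x y) y w)) ^ 2 :=
    hl3'.comp_reindex (Equiv.swap x y)
  have e2 := integral_exchange (ρ := ρ) x y (hl y w)
  have e3 := (integral_exchange (ρ := ρ) x y hl3').trans (integral_exchange y w (hl x y))
  calc energy ρ x w f
      ≤ ∫ η, 3 * ((f (exchange (exchange (exchange η x y) y w) x y) -
          f (exchange (exchange η x y) y w)) ^ 2 +
          (f (exchange (exchange η x y) y w) - f (exchange η x y)) ^ 2 +
          (f (exchange η x y) - f η) ^ 2) ∂(bernoulliProd ρ) := by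
        refine integral_mono (hl x w).integrable
          (((hl3.add hl2).add (hl x y)).integrable.const_mul 3) fun η => ?_
        simp only
        rw [exchange_triple η hxw hyw]
        set a := f (exchange η x w)
        set b := f (exchange (exchange η x y) y w)
        set c := f (exchange η x y)
        nlinarith [sq_nonneg (a - b - (b - c)), sq_nonneg (b - c - (c - f η)),
          sq_nonneg (a - b - (c - f η))]
    _ = 3 * (energy ρ x y f + energy ρ y w f + energy ρ x y f) := by
        rw [integral_const_mul]
        congr 1
        have h23 : IsLocal fun η => (f (exchange (exchange (exchange η x y) y w) x y) -
            f (exchange (exchange η x y) y w)) ^ 2 +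
            (f (exchange (exchange η x y) y w) - f (exchange η x y)) ^ 2 := hl3.add hl2
        rw [integral_add h23.integrable (hl x y).integrable,
          integral_add hl3.integrable hl2.integrable, e2, e3]
        rfl
    _ = _ := by ring

/-- The distances over which exchanges are controlled by the Dirichlet form of the generator,
uniformly in the density. -/
def controlled (p : ℤ → ℝ) : AddSubgroup ℤ where
  carrier := {d | ∃ C : ℝ, 0 ≤ C ∧ ∀ (ρ : unitInterval) (f : Config → ℝ), IsLocal f →
    totalEnergy ρ d f ≤ C * -inner2 ρ f (generator p f)}
  zero_mem' := ⟨0, le_rfl, fun ρ f _ => by simp [totalEnergy, energy_self]⟩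
  neg_mem' := by
    rintro d ⟨C, hC, h⟩
    refine ⟨C, hC, fun ρ f hf => le_trans (le_of_eq ?_) (h ρ f hf)⟩
    have h1 := tsum_energy (ρ := ρ) (f := f) (-d) 0
    rw [sub_neg_eq_add, zero_add] at h1
    rw [← h1]
    exact tsum_congr fun x => by rw [add_zero, energy_comm]
  add_mem' := by
    rintro d e ⟨C, hC, h⟩ ⟨D, hD, h'⟩
    refine ⟨3 * (2 * C + D), by positivity, fun ρ f hf => ?_⟩
    have s1 := summable_energy (ρ := ρ) hf 0 d
    have s2 := summable_energy (ρ := ρ) hf d (d + e)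
    have s3 := summable_energy (ρ := ρ) hf 0 (d + e)
    have t1 := tsum_energy (ρ := ρ) (f := f) 0 d
    have t2 := tsum_energy (ρ := ρ) (f := f) d (d + e)
    have t3 := tsum_energy (ρ := ρ) (f := f) 0 (d + e)
    rw [sub_zero] at t1 t3
    rw [add_sub_cancel_left] at t2
    have h1 : totalEnergy ρ (d + e) f ≤
        3 * (2 * totalEnergy ρ d f + totalEnergy ρ e f) := by
      rw [← t1, ← t2, ← t3, ← tsum_mul_left, ← (s1.mul_left 2).tsum_add s2, ← tsum_mul_left]
      exact s3.tsum_le_tsum (fun x => energy_triangle hf _ _ _)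
        (((s1.mul_left 2).add s2).mul_left 3)
    have h2 := h ρ f hf
    have h3 := h' ρ f hf
    linarith

lemma mem_controlled_of_pos (hp : IsJumpLaw p) {z : ℤ} (hz : 0 < p z) : z ∈ controlled p := by
  obtain ⟨R, hR⟩ := hp.finiteRange
  -- The Dirichlet form contains the energy of the distance z with weight p(z)/4.
  refine ⟨4 / p z, by positivity, fun ρ f hf => ?_⟩
  have hzR : z ∈ Finset.Icc (-R : ℤ) R := by
    rw [Finset.mem_Icc, ← abs_le]
    by_contra h
    exact hz.ne' (hR z (not_le.mp h))
  have h1 := Finset.single_le_sum (f := fun z => p z * totalEnergy ρ z f)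
    (fun z _ => mul_nonneg (hp.nonneg z) (totalEnergy_nonneg z)) hzR
  rw [inner2_generator hR hf, neg_neg, div_mul_eq_mul_div, le_div_iff₀ hz]
  linarith

/-- A generator of this cyclic subgroup of ℤ divides every possible jump, so it is a unit. -/
lemma controlled_eq_top (hp : IsJumpLaw p) (hi : IsIrreducibleLaw p) : controlled p = ⊤ := by
  obtain ⟨d, hd⟩ := Int.subgroup_cyclic (controlled p)
  have h1 : ∀ z, 0 < p z → d ∣ z := fun z hz => by
    have := mem_controlled_of_pos hp hz
    rw [hd, AddSubgroup.mem_closure_singleton] at this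
    obtain ⟨n, hn⟩ := this
    exact ⟨n, by rw [← hn, smul_eq_mul, mul_comm]⟩
  have h2 := Int.isUnit_iff.mp (hi d h1)
  rw [eq_top_iff]
  intro z _
  rw [hd, AddSubgroup.mem_closure_singleton]
  rcases h2 with rfl | rfl
  · exact ⟨z, by simp⟩
  · exact ⟨-z, by simp⟩

end Comparison

/-! ### The currents and the uniform bound -/

section Current

variable {p : ℤ → ℝ} {ρ : unitInterval} {f : Config → ℝ} {R : ℕ}

lemma dependsOn_hatEta (x : ℤ) : DependsOn (hatEta ρ x) (({x} : Finset ℤ) : Set ℤ) :=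
  fun η ξ h => by simp [hatEta, occ, h x (by simp)]

lemma isLocal_hatEta (x : ℤ) : IsLocal (hatEta ρ x) := ⟨{x}, dependsOn_hatEta x⟩

lemma integral_eval (F : Bool → ℝ) (x : ℤ) :
    ∫ η : Config, F (η x) ∂(bernoulliProd ρ) = ρ * F true + (1 - ρ) * F false := by
  have h : MeasurePreserving (Function.eval x) (bernoulliProd ρ)
      (bernoulliMeasure true false ρ) :=
    measurePreserving_eval_infinitePi (fun _ : ℤ => bernoulliMeasure true false ρ) x
  have h1 : AEStronglyMeasurable F ((bernoulliProd ρ).map (Function.eval x)) :=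
    (measurable_of_countable F).aestronglyMeasurable
  have h2 := integral_map h.measurable.aemeasurable h1
  rw [h.map_eq, integral_bernoulliMeasure] at h2
  exact h2.symm

lemma integral_hatEta (x : ℤ) : ∫ η, hatEta ρ x η ∂(bernoulliProd ρ) = 0 := by
  have := integral_eval (ρ := ρ)
    (fun b => ((if b then 1 else 0) - (ρ : ℝ)) / √((ρ : ℝ) * (1 - ρ))) x
  refine this.trans ?_
  simp only [if_true, Bool.false_eq_true, if_false]
  ring

lemma integral_hatEta_sq (h0 : 0 < ρ) (h1 : ρ < 1) (x : ℤ) :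
    ∫ η, hatEta ρ x η ^ 2 ∂(bernoulliProd ρ) = 1 := by
  have := integral_eval (ρ := ρ)
    (fun b => (((if b then 1 else 0) - (ρ : ℝ)) / √((ρ : ℝ) * (1 - ρ))) ^ 2) x
  refine this.trans ?_
  have h0' : (0 : ℝ) < ρ := h0
  have h1' : (0 : ℝ) < 1 - ρ := sub_pos.mpr h1
  simp only [if_true, Bool.false_eq_true, if_false, div_pow]
  rw [Real.sq_sqrt (by positivity)]
  field_simp
  ring

/-- The product of two normalised occupation variables. -/
noncomputable def hatPair (ρ : unitInterval) (x y : ℤ) (η : Config) : ℝ :=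
  hatEta ρ x η * hatEta ρ y η

lemma isLocal_hatPair (x y : ℤ) : IsLocal (hatPair ρ x y) :=
  (isLocal_hatEta x).mul (isLocal_hatEta y)

lemma hatEtaSet_pair {x y : ℤ} (h : x ≠ y) : hatEtaSet ρ {x, y} = hatPair ρ x y := by
  funext η
  exact Finset.prod_pair h

lemma integral_hatPair {x y : ℤ} (h : x ≠ y) :
    ∫ η, hatPair ρ x y η ∂(bernoulliProd ρ) = 0 := by
  refine (integral_mul_of_disjoint (Finset.disjoint_singleton.mpr h) (dependsOn_hatEta x)
    (dependsOn_hatEta y)).trans ?_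
  rw [integral_hatEta, zero_mul]

lemma inner2_hatPair_self (h0 : 0 < ρ) (h1 : ρ < 1) {x y : ℤ} (h : x ≠ y) :
    inner2 ρ (hatPair ρ x y) (hatPair ρ x y) = 1 := by
  have hd : ∀ x, DependsOn (fun η => hatEta ρ x η ^ 2) (({x} : Finset ℤ) : Set ℤ) :=
    fun x η ξ h => congrArg (· ^ 2) (dependsOn_hatEta x h)
  have h2 := integral_mul_of_disjoint (ρ := ρ) (Finset.disjoint_singleton.mpr h) (hd x) (hd y)
  rw [integral_hatEta_sq h0 h1, integral_hatEta_sq h0 h1, one_mul] at h2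
  rw [← h2, inner2]
  refine integral_congr_ae (Eventually.of_forall fun η => ?_)
  simp only [hatPair]
  ring

lemma inner2_comm (f g : Config → ℝ) : inner2 ρ f g = inner2 ρ g f := by
  simp only [inner2, mul_comm]

lemma inner2_sub {g h : Config → ℝ} (hf : IsLocal f) (hg : IsLocal g) (hh : IsLocal h) :
    inner2 ρ f (g - h) = inner2 ρ f g - inner2 ρ f h := by
  have h1 := integral_sub ((hf.mul hg).integrable (ρ := ρ)) (hf.mul hh).integrable
  simp only [inner2, Pi.sub_apply, mul_sub]
  exact h1

lemma inner2_smul (f g : Config → ℝ) (c : ℝ) : inner2 ρ f (c • g) = c * inner2 ρ f g := by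
  simp only [inner2, Pi.smul_apply, smul_eq_mul, mul_left_comm _ c, integral_const_mul]

lemma translate_hatPair (x a b : ℤ) :
    translate x (hatPair ρ a b) = hatPair ρ (x + a) (x + b) := rfl

lemma hatPair_exchange {a x y : ℤ} (hx : a ≠ x) (hy : a ≠ y) (η : Config) :
    hatPair ρ a y (exchange η x y) = hatPair ρ a x η := by
  simp [hatPair, hatEta, occ, exchange, Equiv.swap_apply_of_ne_of_ne hx hy]

/-- The exchange of x and y turns one pair into the other and preserves the measure, so the
difference is a pairing with f(η^{x,y}) − f. Cauchy–Schwarz and the unit norm of the pair give a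
constant free of ρ. -/
lemma inner2_hatPair_sub_sq_le (h0 : 0 < ρ) (h1 : ρ < 1) (hf : IsLocal f) {a x y : ℤ}
    (hx : a ≠ x) (hy : a ≠ y) :
    (inner2 ρ (hatPair ρ a y) f - inner2 ρ (hatPair ρ a x) f) ^ 2 ≤ energy ρ x y f := by
  have hl := isLocal_hatPair (ρ := ρ) a y
  have hd : IsLocal fun η => f (exchange η x y) - f η :=
    (hf.comp_reindex (Equiv.swap x y)).sub hf
  have hfe : IsLocal fun η => f (exchange η x y) := hf.comp_reindex (Equiv.swap x y)
  have h2 : inner2 ρ (hatPair ρ a x) f =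
      ∫ η, hatPair ρ a y η * f (exchange η x y) ∂(bernoulliProd ρ) := by
    have hm : IsLocal fun η => hatPair ρ a y η * f (exchange η x y) := hl.mul hfe
    rw [← integral_exchange x y hm]
    simp only [hatPair_exchange hx hy, exchange_exchange]
    rfl
  have h3 : inner2 ρ (hatPair ρ a y) f - inner2 ρ (hatPair ρ a x) f =
      -inner2 ρ (hatPair ρ a y) fun η => f (exchange η x y) - f η := by
    have h5 := inner2_sub (ρ := ρ) hl hfe hf
    rw [h2]
    change _ = -inner2 ρ (hatPair ρ a y) ((fun η => f (exchange η x y)) - f)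
    rw [h5, neg_sub]
    rfl
  have h4 := real_inner_mul_inner_self_le ((hl.memLp (ρ := ρ) 2).toLp _) ((hd.memLp 2).toLp _)
  rw [inner_toLp, inner_toLp, inner_toLp, inner2_hatPair_self h0 h1 hy, one_mul] at h4
  rw [h3, neg_sq, sq]
  refine h4.trans (le_of_eq ?_)
  refine integral_congr_ae (Eventually.of_forall fun η => ?_)
  simp only
  ring

/-- At z = 0 the set {0, z} collapses to one point and differs from `hatPair ρ 0 0`, but the
coefficient z vanishes. -/
lemma current_sub_eq (hR : ∀ z : ℤ, (R : ℤ) < |z| → p z = 0) :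
    current p ρ - drift p • current tasep ρ =
      ∑ z ∈ Finset.Icc (-R : ℤ) R, (z * p z) • (hatPair ρ 0 z - hatPair ρ 0 1) := by
  have hout : ∀ z ∉ Finset.Icc (-R : ℤ) R, p z = 0 := fun z hz =>
    hR z (by rw [Finset.mem_Icc, ← abs_le] at hz; exact not_le.mp hz)
  funext η
  have h1 : current p ρ η = ∑ z ∈ Finset.Icc (-R : ℤ) R, z * p z * hatPair ρ 0 z η := by
    unfold current
    rw [tsum_eq_sum (s := Finset.Icc (-R : ℤ) R) fun z hz => by rw [hout z hz]; ring]
    refine Finset.sum_congr rfl fun z _ => ?_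
    rcases eq_or_ne z 0 with rfl | hz
    · simp
    · rw [hatEtaSet_pair hz.symm]
  have h2 : current tasep ρ η = hatPair ρ 0 1 η := by
    unfold current
    rw [tsum_eq_single 1 fun z hz => by simp [tasep, hz], hatEtaSet_pair (by norm_num)]
    simp [tasep]
  have h3 : drift p = ∑ z ∈ Finset.Icc (-R : ℤ) R, z * p z :=
    tsum_eq_sum fun z hz => by rw [hout z hz]; ring
  simp only [Pi.sub_apply, Pi.smul_apply, smul_eq_mul, Finset.sum_apply, h1, h2, h3,
    Finset.sum_mul, ← Finset.sum_sub_distrib]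
  exact Finset.sum_congr rfl fun z _ => by ring

/-- For an irreducible jump law `q`, the difference of currents is bounded in the
`H₋₁` norm of the process with jump law `q`. -/
theorem exists_normHm1_current_le {q : ℤ → ℝ} (hq : IsJumpLaw q) (hi : IsIrreducibleLaw q)
    (hp : IsJumpLaw p) :
    ∃ C : ℝ, ∀ ρ : unitInterval, 0 < ρ → ρ < 1 → ∀ lam : ℝ, 0 < lam →
      NormHm1WellDefined q ρ lam (current p ρ - drift p • current tasep ρ) ∧
      normHm1 q ρ lam (current p ρ - drift p • current tasep ρ) ≤ C := by
  obtain ⟨R, hR⟩ := hp.finiteRange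
  have hctrl : ∀ d : ℤ, ∃ C : ℝ, 0 ≤ C ∧ ∀ (ρ : unitInterval) (f : Config → ℝ), IsLocal f →
      totalEnergy ρ d f ≤ C * -inner2 ρ f (generator q f) := fun d => by
    have : d ∈ controlled q := by rw [controlled_eq_top hq hi]; trivial
    exact this
  choose B hB0 hB using hctrl
  set J := Finset.Icc (-R : ℤ) R
  -- The first factor comes from Cauchy–Schwarz in z; `B (z - 1)` is the cost of moving a particle
  -- between x + 1 and x + z.
  set K := (∑ z ∈ J, (z * p z) ^ 2) * ∑ z ∈ J, B (z - 1) with hK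
  refine ⟨√K, fun ρ h0 h1 lam hl => ?_⟩
  set φ := current p ρ - drift p • current tasep ρ with hφ
  have hφs : φ = ∑ z ∈ J, (z * p z) • (hatPair ρ 0 z - hatPair ρ 0 1) := current_sub_eq hR
  have hloc1 : ∀ z : ℤ, IsLocal (hatPair ρ 0 z - hatPair ρ 0 1) := fun z =>
    (isLocal_hatPair 0 z).sub (isLocal_hatPair 0 1)
  have hloc : ∀ z : ℤ, IsLocal ((z * p z) • (hatPair ρ 0 z - hatPair ρ 0 1)) := fun z =>
    (hloc1 z).smul _
  have hφl : IsLocal φ := by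
    rw [hφs]
    exact isLocal_sum _ fun z _ => hloc z
  have hφ0 : ∫ η, φ η ∂(bernoulliProd ρ) = 0 := by
    have h2 : ∫ η, φ η ∂(bernoulliProd ρ) = inner2 ρ (fun _ => 1) φ := by simp [inner2]
    have h3 : ∀ {x y : ℤ}, x ≠ y → inner2 ρ (fun _ => 1) (hatPair ρ x y) = 0 := fun h => by
      simpa [inner2] using integral_hatPair h
    rw [h2, hφs, inner2_sum _ (isLocal_const 1) fun z _ => hloc z]
    refine Finset.sum_eq_zero fun z _ => ?_
    rw [inner2_smul]
    rcases eq_or_ne z 0 with rfl | hz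
    · simp
    · rw [inner2_sub (isLocal_const 1) (isLocal_hatPair 0 z) (isLocal_hatPair 0 1),
        h3 hz.symm, h3 (by norm_num), sub_zero, mul_zero]
  refine normHm1_le hq hl hφl hφ0
    (mul_nonneg (Finset.sum_nonneg fun _ _ => sq_nonneg _)
      (Finset.sum_nonneg fun _ _ => hB0 _)) fun N f hf => ?_
  set D := -inner2 ρ f (generator q f) with hD
  have hD0 : 0 ≤ D := by
    have := genToLp_dissip (ρ := ρ) hq ⟨f, hf⟩
    rw [genToLp_apply, localToLp_apply, localToLp_apply, inner_toLp] at this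
    exact neg_nonneg.mpr this
  set X : ℤ → ℕ → ℝ := fun z x =>
    inner2 ρ (hatPair ρ x (x + z)) f - inner2 ρ (hatPair ρ x (x + 1)) f with hX
  have hexp : ∑ x ∈ Finset.range N, inner2 ρ (translate x φ) f =
      ∑ z ∈ J, z * p z * ∑ x ∈ Finset.range N, X z x := by
    simp only [Finset.mul_sum]
    rw [Finset.sum_comm]
    refine Finset.sum_congr rfl fun x _ => ?_
    have h2 : translate x φ =
        ∑ z ∈ J, (z * p z) • (hatPair ρ x (x + z) - hatPair ρ x (x + 1)) := by
      rw [hφs]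
      funext η
      simp only [translate, Finset.sum_apply, Pi.smul_apply, Pi.sub_apply]
      refine Finset.sum_congr rfl fun z _ => ?_
      have := congrFun (translate_hatPair (ρ := ρ) x 0 z) η
      have h' := congrFun (translate_hatPair (ρ := ρ) x 0 1) η
      simp only [translate, add_zero] at this h'
      rw [this, h']
    rw [h2, inner2_comm, inner2_sum _ hf fun z _ =>
      ((isLocal_hatPair _ _).sub (isLocal_hatPair _ _)).smul _]
    refine Finset.sum_congr rfl fun z _ => ?_
    rw [inner2_smul, inner2_sub hf (isLocal_hatPair _ _) (isLocal_hatPair _ _), inner2_comm f,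
      inner2_comm f]
  -- Cauchy–Schwarz over the N translates costs only a factor N, because the energies of the
  -- translated exchanges add up to at most the total energy.
  have hXz : ∀ z ∈ J, z ≠ 0 → (∑ x ∈ Finset.range N, X z x) ^ 2 ≤ N * (B (z - 1) * D) := by
    intro z _ hz
    calc (∑ x ∈ Finset.range N, X z x) ^ 2
        ≤ N * ∑ x ∈ Finset.range N, X z x ^ 2 := by
          simpa using sq_sum_le_card_mul_sum_sq (s := Finset.range N) (f := X z)
      _ ≤ N * ∑ x ∈ Finset.range N, energy ρ ((x : ℤ) + 1) (x + z) f := by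
          gcongr with x _
          exact inner2_hatPair_sub_sq_le h0 h1 hf (by omega) (by omega)
      _ ≤ N * totalEnergy ρ (z - 1) f := by
          gcongr
          have := Finset.sum_map (Finset.range N) Nat.castEmbedding
            (fun x : ℤ => energy ρ (x + 1) (x + z) f)
          simp only [Nat.castEmbedding_apply] at this
          rw [← tsum_energy, ← this]
          exact (summable_energy hf 1 z).sum_le_tsum _ fun _ _ => energy_nonneg _ _
      _ ≤ _ := by
          gcongr
          exact hB _ ρ f hf
  -- The energy bound fails to apply at z = 0, where both sites of the pair coincide; there the sum
  -- is replaced by 0, harmless because of the coefficient z.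
  set Y : ℤ → ℝ := fun z => if z = 0 then 0 else ∑ x ∈ Finset.range N, X z x with hY
  have hYX : ∑ z ∈ J, z * p z * ∑ x ∈ Finset.range N, X z x = ∑ z ∈ J, z * p z * Y z := by
    refine Finset.sum_congr rfl fun z _ => ?_
    rcases eq_or_ne z 0 with rfl | hz
    · simp
    · simp [hY, hz]
  have hY2 : ∀ z ∈ J, Y z ^ 2 ≤ N * (B (z - 1) * D) := by
    intro z hz
    rcases eq_or_ne z 0 with rfl | hz0
    · have := hB0 (0 - 1)
      simp only [hY, if_true, zero_pow two_ne_zero]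
      positivity
    · simpa [hY, hz0] using hXz z hz hz0
  rw [hexp, hYX]
  calc (∑ z ∈ J, z * p z * Y z) ^ 2
      ≤ (∑ z ∈ J, (z * p z) ^ 2) * ∑ z ∈ J, Y z ^ 2 := Finset.sum_mul_sq_le_sq_mul_sq _ _ _
    _ ≤ (∑ z ∈ J, (z * p z) ^ 2) * ∑ z ∈ J, N * (B (z - 1) * D) := by
        gcongr with z hz
        exact hY2 z hz
    _ = K * N * D := by
        rw [hK, ← Finset.mul_sum, ← Finset.sum_mul]
        ring

lemma isJumpLaw_tasep : IsJumpLaw tasep where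
  nonneg z := by
    unfold tasep
    rcases eq_or_ne z 1 with rfl | hz <;> simp [*]
  finiteRange := ⟨1, fun z hz => by
    have : z ≠ 1 := by rintro rfl; simp at hz
    simp [tasep, this]⟩
  sum_one := by
    rw [tsum_eq_single 1 fun z hz => by simp [tasep, hz]]
    simp [tasep]

lemma isIrreducibleLaw_tasep : IsIrreducibleLaw tasep :=
  fun d hd => isUnit_of_dvd_one (hd 1 (by simp [tasep]))

end Current

end AEP

theorem proposition2p2 (p : ℤ → ℝ) (hp : AEP.IsJumpLaw p) (hb : AEP.drift p ≠ 0) :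
    ∃ C : ℝ, ∀ ρ : unitInterval, 0 < ρ → ρ < 1 → ∀ lam : ℝ, 0 < lam → lam < 1 →
      (AEP.NormHm1WellDefined AEP.tasep ρ lam
          (AEP.current p ρ - AEP.drift p • AEP.current AEP.tasep ρ) ∧
        AEP.normHm1 AEP.tasep ρ lam
          (AEP.current p ρ - AEP.drift p • AEP.current AEP.tasep ρ) ≤ C) ∧
      (AEP.IsIrreducibleLaw p →
        AEP.NormHm1WellDefined p ρ lam
          (AEP.current p ρ - AEP.drift p • AEP.current AEP.tasep ρ) ∧
        AEP.normHm1 p ρ lam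
          (AEP.current p ρ - AEP.drift p • AEP.current AEP.tasep ρ) ≤ C) := by
  obtain ⟨C₁, h₁⟩ :=
    AEP.exists_normHm1_current_le AEP.isJumpLaw_tasep AEP.isIrreducibleLaw_tasep hp
  -- The constant is chosen before irreducibility is assumed, so the second bound enters it only
  -- when `p` is irreducible.
  by_cases hi : AEP.IsIrreducibleLaw p
  · obtain ⟨C₂, h₂⟩ := AEP.exists_normHm1_current_le hp hi hp
    refine ⟨max C₁ C₂, fun ρ h0 h1 lam hl _ => ⟨?_, fun _ => ?_⟩⟩
    · exact ⟨(h₁ ρ h0 h1 lam hl).1, (h₁ ρ h0 h1 lam hl).2.trans (le_max_left _ _)⟩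
    · exact ⟨(h₂ ρ h0 h1 lam hl).1, (h₂ ρ h0 h1 lam hl).2.trans (le_max_right _ _)⟩
  · exact ⟨C₁, fun ρ h0 h1 lam hl _ => ⟨h₁ ρ h0 h1 lam hl, fun h => absurd h hi⟩⟩
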